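/- **Setting.** Let $\mathcal B$ be a BPMN process with finitely many variables, linked to a family $\mathcal D$ of DMN decision tables. $\mathcal B$ is a directed graph with: exactly one start event (no incoming, one outgoing edge); success and error end events (one incoming, no outgoing edge); tasks (one incoming, one outgoing edge); exclusive gateways (one incoming and several outgoing edges, ordered, each labelled with a FEEL condition except for at most one default edge); and joining gateways (several incoming, one outgoing edge). A task writes no variable, or is a user or manual task (as for the start event, values for some variables are chosen by the environment), a script or service task (at most one variable receives the value of a FEEL expression), or a business rule task (a table of $\mathcal D$ is evaluated on FEEL expressions and its outputs are assigned to pairwise different variables). Parallel, inclusive and event-based gateways and send and receive tasks do not occur, and no user or manual task that writes a variable lies on a cycle. A table has rows whose input cells are dashes, constants or ranges and whose outputs are constants, and possibly a default row; it returns the outputs of the first row all of whose input cells are satisfied, otherwise those of the default row, and has no result if there is none. FEEL expressions are built from Boolean, numeric (exact), string, temporal, list, context and range values. Each variable $v$ has a FEEL type with set of values $D_v$; input variables are those written by the start event or by user or manual tasks and those never written; the others are process variables. **Transition system.** States are pairs $s=\langle\sigma(s),\mu(s)\rangle$ of a node and an assignment $\mu(s)\in\prod_v (D_v\cup\{\bot\})$,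 where $\bot$ is the undefined value. $(s,t)\in\delta$ iff (i) there is an edge $w=(\sigma(s),\sigma(t))$; (ii) if $\sigma(s)$ is an exclusive gateway, $w$ is the first of its edges whose condition is true under $\mu(s)$, or $w$ is its default edge and no condition is true; (iii) $\mu(t)$ is obtained from $\mu(s)$ by the actions of $\sigma(s)$ (chosen values being any elements of the domains; there is no such $t$ if a computed value is neither $\bot$ nor in the domain of its variable, or if a table has no result). A path is a finite non-empty sequence $s_1,\dots,s_k$ with $(s_i,s_{i+1})\in\delta$ for $1\le i<k$, where $\sigma(s_1)$ is the start event and $\mu(s_1)$ gives $\bot$ to every process variable (and any values in $D_v\cup\{\bot\}$ to the input variables $v$). **Program.** Let $J(\mathcal B,\mathcal D)$ be the Java program produced from $(\mathcal B,\mathcal D)$ by BDTrans: one class with one member variable per variable (initially null, i.e. $\bot$) and one method per node, and for each table a class whose method consists of nested `if`s over the rows. The method of a node outputs the pair (node, current values of all variables), performs the actions of the node with FEEL expressions translated to Java, and calls the method of the successor; an exclusive gateway is an `if`-`else` chain over its conditions, ended by the call for the default edge. Missing default cases (of gateways and of tables) and failing type casts abort the run. The inputs of a run are an initial value in $D_v\cup\{\bot\}$,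 loaded by the initialization method, and a non-empty list of values in $D_v$ for each input variable $v$; the $j$-th write to $v$ by the start event or by user or manual tasks takes the $j$-th value of the list, or the last one if the list is exhausted. The call stack is unbounded. A trace of $J(\mathcal B,\mathcal D)$ is the non-empty output $\langle(n_1,\nu_1),\dots,(n_k,\nu_k)\rangle$ of a finished or unfinished run on some inputs. **Theorem 1.** For each path $s_1,\dots,s_k$ of $(\mathcal B,\mathcal D)$ there exists exactly one trace $\langle(n_1,\nu_1),\dots,(n_k,\nu_k)\rangle$ of $J(\mathcal B,\mathcal D)$ such that $\sigma(s_i)=n_i$ and $\mu(s_i)=\nu_i$ for all $i=1,\dots,k$. Conversely, for each trace $\langle(n_1,\nu_1),\dots,(n_k,\nu_k)\rangle$ of $J(\mathcal B,\mathcal D)$ there exists exactly one path $s_1,\dots,s_k$ of $(\mathcal B,\mathcal D)$ such that $\sigma(s_i)=n_i$ and $\mu(s_i)=\nu_i$ for all $i=1,\dots,k$. -/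

import Mathlib

noncomputable section

namespace BDT

/-! ## FEEL values

Numbers are exact (FEEL numbers and their Java images are idealised as real numbers),
and `null` is the undefined value, written `⊥` on paper. -/

/-- Kinds of temporal values. -/
inductive TKind
  | date      -- measured in days
  | time      -- measured in seconds since midnight
  | dateTime  -- measured in seconds
  | duration  -- measured in seconds
  deriving DecidableEq

/-- Values of FEEL expressions and of variables. -/
inductive Val : Type
  | null
  | bool (b : Bool)
  | num (x : ℝ)
  | str (s : String)
  | temporal (k : TKind) (t : ℤ)
  | list (l : List Val)
  | context (f : String → Option Val)
  | range (loClosed : Bool) (lo hi : Val) (hiClosed : Bool)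

/-- FEEL types; `any` is the type of all defined values. -/
inductive FType
  | any
  | boolean
  | number
  | string
  | temporal (k : TKind)
  | list
  | context
  | range
  deriving DecidableEq

namespace Val

/-- `v.HasType T`: the defined value `v` belongs to the domain described by `T`. -/
def HasType : Val → FType → Prop
  | null, _ => False
  | _, .any => True
  | bool _, .boolean => True
  | num _, .number => True
  | str _, .string => True
  | temporal k _, .temporal k' => k = k'
  | list _, .list => True
  | context _, .context => True
  | range _ _ _ _, .range => True
  | _, _ => False

/-- The two values are undefined or have a common type. -/
def SameKind (a b : Val) : Prop := ∃ T : FType, T ≠ .any ∧ a.HasType T ∧ b.HasType T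

open Classical in
/-- The FEEL Boolean of a proposition. -/
def ofProp (p : Prop) : Val := bool (decide p)

open Classical in
/-- FEEL equality: defined between values of one type and against `null`. -/
def eq (a b : Val) : Val :=
  if a = b then bool true
  else if a = null ∨ b = null ∨ SameKind a b then bool false else null

/-- FEEL strict order on numbers, strings and temporal values of one kind. -/
def lt : Val → Val → Val
  | num x, num y => ofProp (x < y)
  | str s, str t => ofProp (s < t)
  | temporal k a, temporal k' b => if k = k' then ofProp (a < b) else null
  | _, _ => null

/-- FEEL non-strict order. -/
def le : Val → Val → Val
  | num x, num y => ofProp (x ≤ y)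
  | str s, str t => ofProp (s ≤ t)
  | temporal k a, temporal k' b => if k = k' then ofProp (a ≤ b) else null
  | _, _ => null

/-- Three-valued negation. -/
def not3 : Val → Val
  | bool b => bool (!b)
  | _ => null

/-- Three-valued conjunction. -/
def and3 : Val → Val → Val
  | bool false, _ => bool false
  | _, bool false => bool false
  | bool true, bool true => bool true
  | _, _ => null

/-- Three-valued disjunction. -/
def or3 : Val → Val → Val
  | bool true, _ => bool true
  | _, bool true => bool true
  | bool false, bool false => bool false
  | _, _ => null

/-- Sum of two temporal values; times of day wrap around at midnight. -/
def addTemporal : TKind → ℤ → TKind → ℤ → Val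
  | .duration, a, .duration, b => temporal .duration (a + b)
  | .dateTime, a, .duration, b => temporal .dateTime (a + b)
  | .duration, a, .dateTime, b => temporal .dateTime (a + b)
  | .date, a, .duration, b => temporal .date (a + b / 86400)
  | .duration, a, .date, b => temporal .date (b + a / 86400)
  | .time, a, .duration, b => temporal .time ((a + b) % 86400)
  | .duration, a, .time, b => temporal .time ((a + b) % 86400)
  | .time, a, .time, b => temporal .time ((a + b) % 86400)
  | _, _, _, _ => null

/-- Difference of two temporal values. -/
def subTemporal : TKind → ℤ → TKind → ℤ → Val
  | .duration, a, .duration, b => temporal .duration (a - b)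
  | .dateTime, a, .duration, b => temporal .dateTime (a - b)
  | .date, a, .duration, b => temporal .date (a + (-b) / 86400)
  | .time, a, .duration, b => temporal .time ((a - b) % 86400)
  | .time, a, .time, b => temporal .duration (a - b)
  | .dateTime, a, .dateTime, b => temporal .duration (a - b)
  | .date, a, .date, b => temporal .duration (86400 * (a - b))
  | _, _, _, _ => null

/-- Addition of numbers and of temporal values, concatenation of strings. -/
def add : Val → Val → Val
  | num x, num y => num (x + y)
  | str s, str t => str (s ++ t)
  | temporal k a, temporal k' b => addTemporal k a k' b
  | _, _ => null

def sub : Val → Val → Val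
  | num x, num y => num (x - y)
  | temporal k a, temporal k' b => subTemporal k a k' b
  | _, _ => null

def mul : Val → Val → Val
  | num x, num y => num (x * y)
  | _, _ => null

open Classical in
def div : Val → Val → Val
  | num x, num y => if y = 0 then null else num (x / y)
  | _, _ => null

def neg : Val → Val
  | num x => num (-x)
  | temporal .duration t => temporal .duration (-t)
  | _ => null

def abs : Val → Val
  | num x => num |x|
  | temporal .duration t => temporal .duration |t|
  | _ => null

def floor : Val → Val
  | num x => num (⌊x⌋ : ℤ)
  | _ => null

def ceiling : Val → Val
  | num x => num (⌈x⌉ : ℤ)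
  | _ => null

open Classical in
def sqrt : Val → Val
  | num x => if 0 ≤ x then num (Real.sqrt x) else null
  | _ => null

/-- Length of a string. -/
def length : Val → Val
  | str s => num (s.length : ℕ)
  | _ => null

/-- Coercion to a list: `null` is empty, any other non-list is a singleton. -/
def toList : Val → List Val
  | null => []
  | list l => l
  | v => [v]

/-- Number of elements of a list. -/
def count (v : Val) : Val := num (v.toList.length : ℕ)

/-- Entry of a context; a missing entry is `null`. -/
def get (k : String) : Val → Val
  | context f => (f k).getD null
  | _ => null

/-- A context with one more entry. -/
def put (k : String) : Val → Val → Val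
  | context f, v => context (Function.update f k (some v))
  | _, _ => null

/-- A list with one more element in front. -/
def cons (v : Val) : Val → Val
  | list l => list (v :: l)
  | _ => null

/-- Concatenation of lists. -/
def concat (a b : Val) : Val := list (a.toList ++ b.toList)

open Classical in
/-- `l[i]`, counted from 1, and from the end if `i` is negative. -/
def index (l : Val) : Val → Val
  | num x =>
    if x ≠ (⌊x⌋ : ℤ) then null
    else if 0 < ⌊x⌋ then l.toList.getD (⌊x⌋ - 1).toNat null
    else if ⌊x⌋ < 0 ∧ 0 ≤ (l.toList.length : ℤ) + ⌊x⌋ then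
      l.toList.getD ((l.toList.length : ℤ) + ⌊x⌋).toNat null
    else null
  | _ => null

/-- Membership of a point in a range or in a list. -/
def mem (x : Val) : Val → Val
  | range cl lo hi ch => and3 (if cl then le lo x else lt lo x) (if ch then le x hi else lt x hi)
  | list l => ofProp (x ∈ l)
  | _ => null

/-- The range with given end points, if these are comparable. -/
def mkRange (cl ch : Bool) (lo hi : Val) : Val :=
  match le lo hi with
  | bool _ => range cl lo hi ch
  | _ => null

/-- `a < b` holds. -/
def Less (a b : Val) : Prop := lt a b = bool true

/-- `before(a, b)` on ranges. -/
def before : Val → Val → Val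
  | range _ _ h ch, range cl' l' _ _ => ofProp (Less h l' ∨ (h = l' ∧ ¬ (ch = true ∧ cl' = true)))
  | _, _ => null

/-- `overlaps(a, b)` on ranges. -/
def overlaps : Val → Val → Val
  | range cl l h ch, range cl' l' h' ch' =>
    ofProp ((Less l' h ∨ (h = l' ∧ ch = true ∧ cl' = true)) ∧
      (Less l h' ∨ (l = h' ∧ cl = true ∧ ch' = true)))
  | _, _ => null

/-- `overlaps before(a, b)` on ranges. -/
def overlapsBefore : Val → Val → Val
  | range cl l h ch, range cl' l' h' ch' =>
    ofProp ((Less l l' ∨ (l = l' ∧ cl = true ∧ cl' = false)) ∧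
      (Less l' h ∨ (h = l' ∧ ch = true ∧ cl' = true)) ∧
      (Less h h' ∨ (h = h' ∧ (ch = false ∨ ch' = true))))
  | _, _ => null

/-- `includes(a, b)` for a range `a` and a range or point `b`. -/
def includes : Val → Val → Val
  | range cl l h ch, range cl' l' h' ch' =>
    ofProp ((Less l l' ∨ (l = l' ∧ (cl = true ∨ cl' = false))) ∧
      (Less h' h ∨ (h = h' ∧ (ch = true ∨ ch' = false))))
  | range cl l h ch, x => mem x (range cl l h ch)
  | _, _ => null

open Classical in
/-- `v` if it equals the Boolean true, and the Boolean false otherwise. -/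
def isTrue (v : Val) : Val := ofProp (v = bool true)

end Val

/-! ## FEEL expressions -/

inductive UnOp
  | not | neg | abs | floor | ceiling | sqrt | length | count
  | instanceOf (T : FType)
  | get (key : String)

inductive BinOp
  | add | sub | mul | div
  | eq | ne | lt | le | gt | ge
  | and | or
  | mem | index | cons | concat
  | put (key : String)
  | range (loClosed hiClosed : Bool)
  | before | overlaps | overlapsBefore | includes

/-- Constructs which run over the elements of a list. -/
inductive Binder
  | filter  -- `l[e]`
  | some    -- `some x in l satisfies e`
  | every   -- `every x in l satisfies e`
  | each    -- `for x in l return e`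

/-- FEEL expressions over the variables `Var`. Literals are constants; list and context literals
are built by `cons` and `put`; variables bound by a list construct are de Bruijn indices. -/
inductive Feel (Var : Type*)
  | lit (v : Val)
  | var (x : Var)
  | bound (i : ℕ)
  | un (o : UnOp) (e : Feel Var)
  | bin (o : BinOp) (e₁ e₂ : Feel Var)
  | ite (c e₁ e₂ : Feel Var)
  | iter (b : Binder) (l e : Feel Var)

def UnOp.sem : UnOp → Val → Val
  | .not => Val.not3
  | .neg => Val.neg
  | .abs => Val.abs
  | .floor => Val.floor
  | .ceiling => Val.ceiling
  | .sqrt => Val.sqrt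
  | .length => Val.length
  | .count => Val.count
  | .instanceOf T => fun v => Val.ofProp (v.HasType T)
  | .get k => Val.get k

def BinOp.sem : BinOp → Val → Val → Val
  | .add => Val.add
  | .sub => Val.sub
  | .mul => Val.mul
  | .div => Val.div
  | .eq => Val.eq
  | .ne => fun a b => (Val.eq a b).not3
  | .lt => Val.lt
  | .le => Val.le
  | .gt => fun a b => Val.lt b a
  | .ge => fun a b => Val.le b a
  | .and => Val.and3
  | .or => Val.or3
  | .mem => Val.mem
  | .index => Val.index
  | .cons => Val.cons
  | .concat => Val.concat
  | .put k => Val.put k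
  | .range cl ch => Val.mkRange cl ch
  | .before => Val.before
  | .overlaps => Val.overlaps
  | .overlapsBefore => Val.overlapsBefore
  | .includes => Val.includes

open Classical in
/-- The value of a list construct, from the elements paired with the values of its body. -/
def Binder.collect : Binder → List (Val × Val) → Val
  | .filter, ps => .list ((ps.filter fun p => p.2 = .bool true).map Prod.fst)
  | .some, ps => ps.foldr (fun p r => Val.or3 p.2 r) (.bool false)
  | .every, ps => ps.foldr (fun p r => Val.and3 p.2 r) (.bool true)
  | .each, ps => .list (ps.map Prod.snd)

open Classical in
/-- FEEL semantics under an assignment `μ`; `env` holds the values of bound variables. -/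
def Feel.eval {Var : Type*} (μ : Var → Val) : List Val → Feel Var → Val
  | _, .lit v => v
  | _, .var x => μ x
  | env, .bound i => env.getD i .null
  | env, .un o e => o.sem (e.eval μ env)
  | env, .bin o e₁ e₂ => o.sem (e₁.eval μ env) (e₂.eval μ env)
  | env, .ite c e₁ e₂ => if c.eval μ env = .bool true then e₁.eval μ env else e₂.eval μ env
  | env, .iter b l e =>
    b.collect ((l.eval μ env).toList.map fun v => (v, e.eval μ (v :: env)))

/-! ## DMN decision tables (policy "first") -/

inductive CmpOp
  | lt | le | gt | ge

/-- Input cells: a dash, a constant, a one-sided range, or a two-sided range. -/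
inductive Cell
  | dash
  | const (v : Val)
  | cmp (o : CmpOp) (v : Val)
  | between (loClosed : Bool) (lo hi : Val) (hiClosed : Bool)

structure Row (k n : ℕ) where
  cells : Fin k → Cell
  out : Fin n → Val

/-- A table with `nIn` input and `nOut` output columns; `deflt` is its last, all-dash row. -/
structure DecisionTable where
  nIn : ℕ
  nOut : ℕ
  rows : List (Row nIn nOut)
  deflt : Option (Fin nOut → Val)

/-- The input value `x` satisfies the cell. -/
def Cell.Sat (x : Val) : Cell → Prop
  | .dash => True
  | .const v => x = v
  | .cmp .lt v => Val.lt x v = .bool true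
  | .cmp .le v => Val.le x v = .bool true
  | .cmp .gt v => Val.lt v x = .bool true
  | .cmp .ge v => Val.le v x = .bool true
  | .between cl lo hi ch =>
    (if cl then Val.le lo x = .bool true else Val.lt lo x = .bool true) ∧
    (if ch then Val.le x hi = .bool true else Val.lt x hi = .bool true)

def Row.Sat {k n : ℕ} (r : Row k n) (x : Fin k → Val) : Prop := ∀ j, (r.cells j).Sat (x j)

/-- On inputs `x` the table yields the outputs `y`: those of the first satisfied row, or those of
the default row if no row is satisfied. Without a default row there may be no result. -/
def DecisionTable.Yields (T : DecisionTable) (x : Fin T.nIn → Val) (y : Fin T.nOut → Val) : Prop :=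
  (∃ pre r post, T.rows = pre ++ r :: post ∧ (∀ r' ∈ pre, ¬ r'.Sat x) ∧ r.Sat x ∧ y = r.out) ∨
  ((∀ r ∈ T.rows, ¬ r.Sat x) ∧ T.deflt = some y)

/-! ## BPMN processes

The elements are those without concurrency, messages and external events: there are no parallel,
inclusive and event-based gateways and no send and receive tasks. `Tab` indexes the linked
decision tables `D`. -/

inductive Guard (Var : Type*)
  | none
  | cond (e : Feel Var)
  | dflt

/-- Sequence flows, the edges of the process. -/
structure Flow (Node Var : Type*) where
  src : Node
  tgt : Node
  guard : Guard Var

inductive Kind (Var : Type*) {Tab : Type*} (D : Tab → DecisionTable)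
  /-- A start event, with the variables that it writes. -/
  | start (ws : List Var)
  | endEvent (isError : Bool)
  /-- A task that writes no variable. -/
  | task
  | userTask (ws : List Var)
  | manualTask (ws : List Var)
  | scriptTask (w : Option (Var × Feel Var))
  | serviceTask (w : Option (Var × Feel Var))
  /-- A call of the table `d`, with the expressions for its inputs and the variables that
  receive its outputs. -/
  | businessRuleTask (d : Tab) (ins : Fin (D d).nIn → Feel Var) (outs : Fin (D d).nOut → Var)
  /-- An exclusive splitting gateway. -/
  | exclusive
  /-- A joining gateway. -/
  | joining

/-- A BPMN process with its linked decision tables. The order of `flows` is the order in which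
the edges leaving a gateway are tried. -/
structure BPMN (Node Var : Type*) {Tab : Type*} (D : Tab → DecisionTable) where
  kind : Node → Kind Var D
  flows : List (Flow Node Var)
  startNode : Node
  varType : Var → FType

section

variable {Node Var Tab : Type*} {D : Tab → DecisionTable}

/-- The variables whose written value is chosen by the environment. -/
def Kind.userWrites : Kind Var D → List Var
  | .start ws => ws
  | .userTask ws => ws
  | .manualTask ws => ws
  | _ => []

def Kind.IsStart : Kind Var D → Prop
  | .start _ => True
  | _ => False

/-- The element writes the variable `v` by a computation of the process. -/
def Kind.Computes (v : Var) : Kind Var D → Prop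
  | .scriptTask w => ∃ e, w = some (v, e)
  | .serviceTask w => ∃ e, w = some (v, e)
  | .businessRuleTask _ _ outs => ∃ j, outs j = v
  | _ => False

namespace BPMN

/-- Input variables: those written by start events, user tasks or manual tasks, and those never
written. All other variables are process variables. -/
def IsInput (B : BPMN Node Var D) (v : Var) : Prop :=
  (∃ n, v ∈ (B.kind n).userWrites) ∨ ∀ n, ¬ (B.kind n).Computes v

def Edge (B : BPMN Node Var D) (m n : Node) : Prop := ∃ w ∈ B.flows, w.src = m ∧ w.tgt = n

/-- No task that sets an input variable lies on a loop. -/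
def NoInputInLoop (B : BPMN Node Var D) : Prop :=
  ∀ n, (B.kind n).userWrites ≠ [] → ¬ Relation.TransGen B.Edge n n

variable [DecidableEq Node]

def outFlows (B : BPMN Node Var D) (n : Node) : List (Flow Node Var) :=
  B.flows.filter fun w => w.src = n

def inFlows (B : BPMN Node Var D) (n : Node) : List (Flow Node Var) :=
  B.flows.filter fun w => w.tgt = n

/-- The numbers of edges entering and leaving an element, and the labels on the latter. -/
def DegreesOK (B : BPMN Node Var D) (n : Node) : Prop :=
  match B.kind n with
  | .start _ => B.inFlows n = [] ∧ ∃ w, B.outFlows n = [w] ∧ w.guard = .none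
  | .endEvent _ => (B.inFlows n).length = 1 ∧ B.outFlows n = []
  | .exclusive => (B.inFlows n).length = 1 ∧ 2 ≤ (B.outFlows n).length ∧
      (∀ w ∈ B.outFlows n, w.guard ≠ .none) ∧
      (B.outFlows n).Pairwise fun w w' => ¬ (w.guard = .dflt ∧ w'.guard = .dflt)
  | .joining => 2 ≤ (B.inFlows n).length ∧ ∃ w, B.outFlows n = [w] ∧ w.guard = .none
  | _ => (B.inFlows n).length = 1 ∧ ∃ w, B.outFlows n = [w] ∧ w.guard = .none

/-- The process is a BPMN diagram: one start event, the right edges at each element, and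
different output columns of a table linked to different variables. -/
structure WellFormed (B : BPMN Node Var D) : Prop where
  start : ∀ n, (B.kind n).IsStart ↔ n = B.startNode
  degrees : ∀ n, B.DegreesOK n
  outputs : ∀ n d ins outs, B.kind n = .businessRuleTask d ins outs → Function.Injective outs

end BPMN

/-! ## The transition system of a process -/

/-- A node together with an assignment of values to all variables. -/
@[ext] structure State (Node Var : Type*) where
  node : Node
  val : Var → Val

/-- A flow labelled with a condition that holds under `μ`. -/
def Flow.Holds (w : Flow Node Var) (μ : Var → Val) : Prop :=
  ∃ e, w.guard = .cond e ∧ e.eval μ [] = .bool true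

namespace BPMN

/-- The values which the variable `v` may take, the undefined value included. -/
def Admissible (B : BPMN Node Var D) (v : Var) (x : Val) : Prop :=
  x = .null ∨ x.HasType (B.varType v)

/-- The state space: every variable is undefined or has a value in its domain. -/
def stateSpace (B : BPMN Node Var D) : Set (State Node Var) :=
  {s | ∀ v, B.Admissible v (s.val v)}

/-- `μ'` results from `μ` by the actions of the node `n`. -/
def Acts (B : BPMN Node Var D) (n : Node) (μ μ' : Var → Val) : Prop :=
  match B.kind n with
  | .start ws | .userTask ws | .manualTask ws =>
      (∀ v ∈ ws, (μ' v).HasType (B.varType v)) ∧ ∀ v, v ∉ ws → μ' v = μ v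
  | .scriptTask (some (x, e)) | .serviceTask (some (x, e)) =>
      μ' x = e.eval μ [] ∧ ∀ v, v ≠ x → μ' v = μ v
  | .businessRuleTask d ins outs =>
      (D d).Yields (fun j => (ins j).eval μ []) (fun j => μ' (outs j)) ∧
        ∀ v, (∀ j, outs j ≠ v) → μ' v = μ v
  | _ => μ' = μ

variable [DecidableEq Node]

/-- The flow `w` may be followed under `μ`: at an exclusive gateway, `w` is the first flow whose
condition is true, or `w` is the default flow and no condition is true. -/
def Open (B : BPMN Node Var D) (μ : Var → Val) (w : Flow Node Var) : Prop :=
  match w.guard with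
  | .none => True
  | .cond _ => w.Holds μ ∧
      ∃ pre post, B.outFlows w.src = pre ++ w :: post ∧ ∀ w' ∈ pre, ¬ w'.Holds μ
  | .dflt => ∀ w' ∈ B.outFlows w.src, ¬ w'.Holds μ

/-- The transition relation. -/
def Trans (B : BPMN Node Var D) (s t : State Node Var) : Prop :=
  s ∈ B.stateSpace ∧ t ∈ B.stateSpace ∧
  (∃ w ∈ B.flows, w.src = s.node ∧ w.tgt = t.node ∧ B.Open s.val w) ∧
  B.Acts s.node s.val t.val

/-- Initial states: at a start event, with all process variables undefined. -/
def Initial (B : BPMN Node Var D) (s : State Node Var) : Prop :=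
  s ∈ B.stateSpace ∧ (B.kind s.node).IsStart ∧ ∀ v, ¬ B.IsInput v → s.val v = .null

/-- Paths: finite non-empty sequences of states, linked by transitions, from an initial state. -/
def IsPath (B : BPMN Node Var D) (p : List (State Node Var)) : Prop :=
  (∃ s, p.head? = some s ∧ B.Initial s) ∧ p.IsChain B.Trans

end BPMN

end

/-! ## Java programs

The fragment of Java in which the generated classes are written, on top of the run-time library
`BeL`, whose static methods operate on FEEL values. -/

/-- Unary methods of the library. -/
inductive Lib1
  | isTrue
  | not | neg | abs | floor | ceiling | sqrt | length | count
  | instanceOf (T : FType)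
  | get (key : String)

/-- Binary methods of the library. -/
inductive Lib2
  | add | sub | mul | div
  | equals | lessThan | lessEq
  | and | or
  | contains | index | cons | concat
  | put (key : String)
  | range (loClosed hiClosed : Bool)
  | before | overlaps | overlapsBefore | includes

/-- Java expressions. -/
inductive JExpr (Var : Type*)
  | const (v : Val)
  /-- A member variable `this.x` of the process class. -/
  | field (x : Var)
  /-- The member `in_j` of the object holding the arguments of a table. -/
  | arg (j : ℕ)
  /-- The member `out_j` of the object holding the results of a table. -/
  | res (j : ℕ)
  /-- A parameter of an enclosing lambda expression, counted from the innermost. -/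
  | param (i : ℕ)
  | call1 (f : Lib1) (e : JExpr Var)
  | call2 (f : Lib2) (e₁ e₂ : JExpr Var)
  /-- `e₁ && e₂`, evaluated lazily. -/
  | andAlso (e₁ e₂ : JExpr Var)
  /-- `c ? e₁ : e₂`. -/
  | ternary (c e₁ e₂ : JExpr Var)
  /-- `(T) e`. -/
  | cast (T : FType) (e : JExpr Var)
  /-- A library method applied to a list and a lambda expression with body `e`. -/
  | higher (b : Binder) (l e : JExpr Var)

/-- Names of the member methods of the process class: three fixed ones and one per element. -/
inductive MName (Node : Type*)
  | main | init | execute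
  | elem (n : Node)

/-- Java statements. -/
inductive Stmt (Node Var Tab : Type*)
  | skip
  | seq (s t : Stmt Node Var Tab)
  | ifElse (c : JExpr Var) (s t : Stmt Node Var Tab)
  /-- `this.x = e`. -/
  | assign (x : Var) (e : JExpr Var)
  /-- `this.x = (T) v`, where `v` is the initial value of `x` in the inputs file. -/
  | load (x : Var) (T : FType)
  /-- `this.x = (T) v`, where `v` is the next input value for `x`. -/
  | input (x : Var) (T : FType)
  /-- Call of a member method. -/
  | invoke (m : MName Node)
  /-- `args.in_j = e`. -/
  | setArg (j : ℕ) (e : JExpr Var)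
  /-- `res.out_j = e`. -/
  | setRes (j : ℕ) (e : JExpr Var)
  /-- `res = d.execute(args)`, for the class of the table `d`. -/
  | decide (d : Tab)
  /-- Output of a trace entry: the node and the current values of all variables. -/
  | trace (n : Node)
  /-- Report of a successful end event. -/
  | success
  /-- Report of an error end event. -/
  | error
  /-- Abortion of the whole run with a failure. -/
  | fail

/-- A process class, with its member variables `Var` and methods, and the classes of the tables,
each with its static method `execute`. -/
structure JProgram (Node Var Tab : Type*) where
  method : MName Node → Stmt Node Var Tab
  table : Tab → Stmt Node Var Tab

def Lib1.sem : Lib1 → Val → Val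
  | .isTrue => Val.isTrue
  | .not => Val.not3
  | .neg => Val.neg
  | .abs => Val.abs
  | .floor => Val.floor
  | .ceiling => Val.ceiling
  | .sqrt => Val.sqrt
  | .length => Val.length
  | .count => Val.count
  | .instanceOf T => fun v => Val.ofProp (v.HasType T)
  | .get k => Val.get k

def Lib2.sem : Lib2 → Val → Val → Val
  | .add => Val.add
  | .sub => Val.sub
  | .mul => Val.mul
  | .div => Val.div
  | .equals => Val.eq
  | .lessThan => Val.lt
  | .lessEq => Val.le
  | .and => Val.and3
  | .or => Val.or3
  | .contains => fun l x => Val.mem x l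
  | .index => Val.index
  | .cons => Val.cons
  | .concat => Val.concat
  | .put k => Val.put k
  | .range cl ch => Val.mkRange cl ch
  | .before => Val.before
  | .overlaps => Val.overlaps
  | .overlapsBefore => Val.overlapsBefore
  | .includes => Val.includes

open Classical in
/-- The Java cast: `null` may be cast to every type; `none` is a `ClassCastException`. -/
def castTo (T : FType) (v : Val) : Option Val :=
  if v = .null ∨ v.HasType T then some v else none

section

variable {Node Var Tab : Type*}

/-- Evaluation of Java expressions; `none` means that an exception is thrown. -/
def JExpr.eval (fields : Var → Val) (args res : ℕ → Val) : List Val → JExpr Var → Option Val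
  | _, .const v => some v
  | _, .field x => some (fields x)
  | _, .arg j => some (args j)
  | _, .res j => some (res j)
  | env, .param i => env[i]?
  | env, .call1 f e => (e.eval fields args res env).map f.sem
  | env, .call2 f e₁ e₂ =>
    (e₁.eval fields args res env).bind fun v₁ => (e₂.eval fields args res env).map (f.sem v₁)
  | env, .andAlso e₁ e₂ =>
    match e₁.eval fields args res env with
    | some (.bool true) =>
      match e₂.eval fields args res env with
      | some (.bool b) => some (.bool b)
      | _ => none
    | some (.bool false) => some (.bool false)
    | _ => none
  | env, .ternary c e₁ e₂ =>
    match c.eval fields args res env with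
    | some (.bool true) => e₁.eval fields args res env
    | some (.bool false) => e₂.eval fields args res env
    | _ => none
  | env, .cast T e => (e.eval fields args res env).bind (castTo T)
  | env, .higher b l e =>
    (l.eval fields args res env).bind fun v =>
      (v.toList.mapM fun u => (e.eval fields args res (u :: env)).map fun r => (u, r)).map b.collect

/-- The inputs of a run: an initial value for each input variable, and the list of the values that
start events, user tasks and manual tasks assign to it one after the other. -/
structure Inputs (Var : Type*) where
  initial : Var → Val
  values : Var → List Val

/-- Input number `j` (from 0) for `v`; once the list is used up, its last value again. -/
def Inputs.pick (ι : Inputs Var) (v : Var) (j : ℕ) : Val :=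
  (ι.values v).getD j ((ι.values v).getLastD .null)

/-- A stack frame: the statements still to be run and the local argument and result objects;
the frame of a table hands its result object to the caller on return. -/
structure Frame (Node Var Tab : Type*) where
  code : List (Stmt Node Var Tab)
  args : ℕ → Val
  res : ℕ → Val
  isTable : Bool

inductive Outcome
  | success | error | failure

/-- Run-time configurations: the call stack (of unbounded size), the member variables, the number
of input values already used, the trace output so far, and the reported outcome. -/
structure Config (Node Var Tab : Type*) where
  stack : List (Frame Node Var Tab)
  fields : Var → Val
  used : Var → ℕ
  out : List (Node × (Var → Val))
  outcome : Option Outcome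

/-- The run ends at once with a failure. -/
def Config.abort (c : Config Node Var Tab) : Config Node Var Tab :=
  { c with stack := [], outcome := some .failure }

/-- Return of the frame `f` to the frames `fs` below it. -/
def popFrame (f : Frame Node Var Tab) : List (Frame Node Var Tab) → List (Frame Node Var Tab)
  | [] => []
  | g :: gs => (if f.isTable then { g with res := f.res } else g) :: gs

/-- A fresh frame for a method body. -/
def newFrame (s : Stmt Node Var Tab) (args : ℕ → Val) (isTable : Bool) : Frame Node Var Tab :=
  ⟨[s], args, fun _ => .null, isTable⟩

variable [DecidableEq Var]

/-- One step: run the statement `s` in the frame `f`, whose remaining code is `f.code`, above the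
frames `fs`. -/
def execStmt (J : JProgram Node Var Tab) (ι : Inputs Var) (c : Config Node Var Tab)
    (f : Frame Node Var Tab) (fs : List (Frame Node Var Tab)) :
    Stmt Node Var Tab → Config Node Var Tab
  | .skip => { c with stack := f :: fs }
  | .seq s t => { c with stack := { f with code := s :: t :: f.code } :: fs }
  | .ifElse e s t =>
    match e.eval c.fields f.args f.res [] with
    | some (.bool true) => { c with stack := { f with code := s :: f.code } :: fs }
    | some (.bool false) => { c with stack := { f with code := t :: f.code } :: fs }
    | _ => c.abort
  | .assign x e =>
    match e.eval c.fields f.args f.res [] with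
    | some v => { c with stack := f :: fs, fields := Function.update c.fields x v }
    | none => c.abort
  | .load x T =>
    match castTo T (ι.initial x) with
    | some v => { c with stack := f :: fs, fields := Function.update c.fields x v }
    | none => c.abort
  | .input x T =>
    match castTo T (ι.pick x (c.used x)) with
    | some v => { c with stack := f :: fs, fields := Function.update c.fields x v,
                         used := Function.update c.used x (c.used x + 1) }
    | none => c.abort
  | .invoke m => { c with stack := newFrame (J.method m) (fun _ => .null) false :: f :: fs }
  | .setArg j e =>
    match e.eval c.fields f.args f.res [] with
    | some v => { c with stack := { f with args := Function.update f.args j v } :: fs }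
    | none => c.abort
  | .setRes j e =>
    match e.eval c.fields f.args f.res [] with
    | some v => { c with stack := { f with res := Function.update f.res j v } :: fs }
    | none => c.abort
  | .decide d => { c with stack := newFrame (J.table d) f.args true :: f :: fs }
  | .trace n => { c with stack := f :: fs, out := c.out ++ [(n, c.fields)] }
  | .success => { c with stack := f :: fs, outcome := some .success }
  | .error => { c with stack := f :: fs, outcome := some .error }
  | .fail => c.abort

/-- One step of a run; a run is over when the call stack is empty. -/
def step (J : JProgram Node Var Tab) (ι : Inputs Var) (c : Config Node Var Tab) :
    Option (Config Node Var Tab) :=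
  match c.stack with
  | [] => none
  | f :: fs =>
    match f.code with
    | [] => some { c with stack := popFrame f fs }
    | s :: rest => some (execStmt J ι c { f with code := rest } fs s)

/-- The start of a run: `main` is called and all member variables are `null`. -/
def initialConfig (J : JProgram Node Var Tab) : Config Node Var Tab where
  stack := [newFrame (J.method .main) (fun _ => .null) false]
  fields := fun _ => .null
  used := fun _ => 0
  out := []
  outcome := none

/-- A legal inputs file for the input variables `V`, listed with their types. -/
def Inputs.Legal (ι : Inputs Var) (V : List (Var × FType)) : Prop :=
  ∀ p ∈ V, (ι.initial p.1 = .null ∨ (ι.initial p.1).HasType p.2) ∧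
    ι.values p.1 ≠ [] ∧ ∀ w ∈ ι.values p.1, w.HasType p.2

/-- Traces of a program with input variables `V`: the non-empty outputs of its runs, finished or
not, on legal inputs. -/
def IsTrace (J : JProgram Node Var Tab) (V : List (Var × FType))
    (tr : List (Node × (Var → Val))) : Prop :=
  tr ≠ [] ∧ ∃ ι : Inputs Var, ι.Legal V ∧ ∃ c,
    Relation.ReflTransGen (fun c c' => step J ι c = some c') (initialConfig J) c ∧ c.out = tr

end

/-! ## The translation -/

section

variable {Node Var Tab : Type*}

def UnOp.toLib : UnOp → Lib1
  | .not => .not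
  | .neg => .neg
  | .abs => .abs
  | .floor => .floor
  | .ceiling => .ceiling
  | .sqrt => .sqrt
  | .length => .length
  | .count => .count
  | .instanceOf T => .instanceOf T
  | .get k => .get k

def BinOp.toJava (o : BinOp) (a b : JExpr Var) : JExpr Var :=
  match o with
  | .add => .call2 .add a b
  | .sub => .call2 .sub a b
  | .mul => .call2 .mul a b
  | .div => .call2 .div a b
  | .eq => .call2 .equals a b
  | .ne => .call1 .not (.call2 .equals a b)
  | .lt => .call2 .lessThan a b
  | .le => .call2 .lessEq a b
  | .gt => .call2 .lessThan b a
  | .ge => .call2 .lessEq b a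
  | .and => .call2 .and a b
  | .or => .call2 .or a b
  | .mem => .call2 .contains b a
  | .index => .call2 .index a b
  | .cons => .call2 .cons a b
  | .concat => .call2 .concat a b
  | .put k => .call2 (.put k) a b
  | .range cl ch => .call2 (.range cl ch) a b
  | .before => .call2 .before a b
  | .overlaps => .call2 .overlaps a b
  | .overlapsBefore => .call2 .overlapsBefore a b
  | .includes => .call2 .includes a b

/-- Translation of FEEL expressions below `depth` binders; an index that is bound nowhere
is `null`. -/
def feelToJava : ℕ → Feel Var → JExpr Var
  | _, .lit v => .const v
  | _, .var x => .field x
  | depth, .bound i => if i < depth then .param i else .const .null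
  | depth, .un o e => .call1 o.toLib (feelToJava depth e)
  | depth, .bin o e₁ e₂ => o.toJava (feelToJava depth e₁) (feelToJava depth e₂)
  | depth, .ite c e₁ e₂ =>
    .ternary (.call1 .isTrue (feelToJava depth c)) (feelToJava depth e₁) (feelToJava depth e₂)
  | depth, .iter b l e => .higher b (feelToJava depth l) (feelToJava (depth + 1) e)

/-- A FEEL condition as the guard of an `if`. -/
def guardToJava (e : Feel Var) : JExpr Var := .call1 .isTrue (feelToJava 0 e)

/-- A block of statements. -/
def block (l : List (Stmt Node Var Tab)) : Stmt Node Var Tab := l.foldr .seq .skip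

/-- The Java condition of a cell in input column `j`. -/
def Cell.toJava (j : ℕ) : Cell → JExpr Var
  | .dash => .const (.bool true)
  | .const v => .call1 .isTrue (.call2 .equals (.arg j) (.const v))
  | .cmp .lt v => .call1 .isTrue (.call2 .lessThan (.arg j) (.const v))
  | .cmp .le v => .call1 .isTrue (.call2 .lessEq (.arg j) (.const v))
  | .cmp .gt v => .call1 .isTrue (.call2 .lessThan (.const v) (.arg j))
  | .cmp .ge v => .call1 .isTrue (.call2 .lessEq (.const v) (.arg j))
  | .between cl lo hi ch =>
    .call1 .isTrue (.call2 .contains (.const (.range cl lo hi ch)) (.arg j))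

def Row.toJava {k n : ℕ} (r : Row k n) : JExpr Var :=
  (List.finRange k).foldr (fun j e => .andAlso ((r.cells j).toJava j) e) (.const (.bool true))

/-- Assignment of all members of the result object. -/
def setResults {n : ℕ} (y : Fin n → Val) : Stmt Node Var Tab :=
  block ((List.finRange n).map fun (j : Fin n) => .setRes j (.const (y j)))

/-- The method `execute` of a table: nested `if`s, ending with the default row or a failure. -/
def translateDMN (T : DecisionTable) : Stmt Node Var Tab :=
  T.rows.foldr (fun r s => .ifElse r.toJava (setResults r.out) s)
    (match T.deflt with
      | some y => setResults y
      | none => .fail)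

variable {D : Tab → DecisionTable}

/-- The assignment `this.x = (T) e` for a script or service task. -/
def assignFeel (ty : Var → FType) : Option (Var × Feel Var) → Stmt Node Var Tab
  | some (x, e) => .assign x (.cast (ty x) (feelToJava 0 e))
  | none => .skip

/-- Reading of input values into variables, in order. -/
def readInputs (ty : Var → FType) (ws : List Var) : Stmt Node Var Tab :=
  block (ws.map fun x => .input x (ty x))

/-- Body of a business rule task: pack the arguments, execute the table, unpack the results. -/
def translateB (D : Tab → DecisionTable) (ty : Var → FType) (d : Tab)
    (ins : Fin (D d).nIn → Feel Var) (outs : Fin (D d).nOut → Var) : Stmt Node Var Tab :=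
  block [
    block ((List.finRange (D d).nIn).map fun (j : Fin (D d).nIn) =>
      .setArg j (feelToJava 0 (ins j))),
    .decide d,
    block ((List.finRange (D d).nOut).map fun (j : Fin (D d).nOut) =>
      .assign (outs j) (.cast (ty (outs j)) (.res j)))]

/-- Body of an exclusive gateway: an `if` for each condition, ending with the default flow or,
if there is none, with a failure. -/
def translateG : List (Flow Node Var) → Stmt Node Var Tab → Stmt Node Var Tab
  | [], last => last
  | w :: ws, last =>
    match w.guard with
    | .cond e => .ifElse (guardToJava e) (.invoke (.elem w.tgt)) (translateG ws last)
    | .dflt => translateG ws (.invoke (.elem w.tgt))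
    | .none => translateG ws last

/-- The call of the method of the next element. -/
def callNext : List (Flow Node Var) → Stmt Node Var Tab
  | w :: _ => .invoke (.elem w.tgt)
  | [] => .skip

namespace BPMN

open Classical in
/-- The input variables with their types. -/
def inputVars [Fintype Var] (B : BPMN Node Var D) : List (Var × FType) :=
  ((Finset.univ : Finset Var).toList.filter fun v => B.IsInput v).map fun v => (v, B.varType v)

variable [DecidableEq Node]

/-- The method of an element: it outputs a trace entry, performs the actions of the element, and
calls the method of the next element. -/
def translateElem (B : BPMN Node Var D) (n : Node) : Stmt Node Var Tab :=
  .seq (.trace n)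
    (match B.kind n with
      | .start ws | .userTask ws | .manualTask ws =>
        .seq (readInputs B.varType ws) (callNext (B.outFlows n))
      | .endEvent false => .success
      | .endEvent true => .error
      | .task | .joining => callNext (B.outFlows n)
      | .scriptTask w | .serviceTask w =>
        .seq (assignFeel B.varType w) (callNext (B.outFlows n))
      | .businessRuleTask d ins outs =>
        .seq (translateB D B.varType d ins outs) (callNext (B.outFlows n))
      | .exclusive => translateG (B.outFlows n) .fail)

/-- The process class with its methods, and the table classes. -/
def translate [Fintype Var] (B : BPMN Node Var D) : JProgram Node Var Tab where
  method
    | .main => .seq (.invoke .init) (.invoke .execute)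
    | .init => block (B.inputVars.map fun p => .load p.1 p.2)
    | .execute => .invoke (.elem B.startNode)
    | .elem n => B.translateElem n
  table d := translateDMN (D d)

end BPMN

/-- The output of the translation: the program, the input variables and the process graph. -/
structure Output (Node Var Tab : Type*) where
  program : JProgram Node Var Tab
  inputs : List (Var × FType)
  graph : List (Node × Node)

/-- The translation of a process with its decision tables. -/
def BDTrans [DecidableEq Node] [Fintype Var] (B : BPMN Node Var D) : Output Node Var Tab where
  program := B.translate
  inputs := B.inputVars
  graph := B.flows.map fun w => (w.src, w.tgt)

/-- A path and a trace of equal length agree, entry by entry, in nodes and in values. -/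
def Corresponds (p : List (State Node Var)) (tr : List (Node × (Var → Val))) : Prop :=
  List.Forall₂ (fun s e => s.node = e.1 ∧ ∀ v, s.val v = e.2 v) p tr

end

end BDT

end

noncomputable section

namespace BDT

/-! ## Evaluation of translated expressions -/

section

variable {Node Var Tab : Type*}

/-! The program simulates the transition system one method call per transition. When the method of a
node is entered with the values of a state `s`, it outputs `s` and then does one of two things.
Either it enters the method of a successor state of `s`, or it finishes with no further output, and
the latter happens only if `s` has no transition. This is `Advances`, proved for all kinds of nodes
in `advances`. It rests on three facts: translated FEEL expressions have the FEEL value and never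
throw (`Feel.eval_feelToJava`), nested `if`s compute the result of a table (`reaches_translateDMN`),
and the gateway chain selects an open flow (`reaches_translateG`). The cases without successor
(missing defaults, failing casts, end events) are exactly those in which the run stops.

For fixed inputs a run is linear, since `step` is a function, and its output only grows. Hence the
output at any moment of a run lists a chain of transitions, by induction on the number of entries
(`exists_chain_of_reaches`).

Conversely, the only freedom in a transition is the choice of the values read in
(`BPMN.Trans.unique`). Given a path, these choices are collected, variable by variable, into input
lists (`BPMN.writes`). The run on these inputs follows the path (`exists_reaches_of_chain`).

Uniqueness in both directions is formal: a path and a trace correspond iff the trace is the image of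
the path under the injective map `State.toEntry`. -/

theorem Val.ofProp_of_true {p : Prop} (h : p) : Val.ofProp p = .bool true := by
  simp [Val.ofProp, h]

theorem Val.ofProp_of_false {p : Prop} (h : ¬ p) : Val.ofProp p = .bool false := by
  simp [Val.ofProp, h]

theorem Val.eq_eq_true_iff (a b : Val) : Val.eq a b = .bool true ↔ a = b := by
  unfold Val.eq
  split_ifs <;> simp_all

theorem Val.and3_eq_true_iff (a b : Val) :
    Val.and3 a b = .bool true ↔ a = .bool true ∧ b = .bool true := by
  unfold Val.and3
  split <;> simp_all

theorem mapM_some {α β : Type*} {f : α → Option β} {g : α → β} (h : ∀ a, f a = some (g a))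
    (l : List α) : l.mapM f = some (l.map g) := by
  induction l with
  | nil => rfl
  | cons a l ih => simp [h, ih]

/-- The translation depth is the length of the environment, and both grow by one under a list
construct. An index beyond the environment is `null` on both sides. The condition of a ternary is
wrapped in `isTrue`, so an undefined condition selects the second branch, as in FEEL, instead of
throwing. -/
theorem Feel.eval_feelToJava (μ : Var → Val) (a r : ℕ → Val) (e : Feel Var) :
    ∀ (env : List Val),
      (feelToJava env.length e).eval μ a r env = some (e.eval μ env) := by
  induction e with
  | lit v => intro env; simp [feelToJava, JExpr.eval, Feel.eval]
  | var x => intro env; simp [feelToJava, JExpr.eval, Feel.eval]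
  | bound i =>
    intro env
    by_cases h : i < env.length
    · simp [feelToJava, JExpr.eval, Feel.eval, h]
    · simp [feelToJava, JExpr.eval, Feel.eval, h]
  | un o e ih =>
    intro env
    simp only [feelToJava, JExpr.eval, Feel.eval, ih, Option.map_some]
    cases o <;> rfl
  | bin o e₁ e₂ ih₁ ih₂ =>
    intro env
    cases o <;>
      simp [feelToJava, BinOp.toJava, JExpr.eval, Feel.eval, ih₁, ih₂, BinOp.sem, Lib2.sem,
        Lib1.sem]
  | ite c e₁ e₂ ihc ih₁ ih₂ =>
    intro env
    by_cases h : c.eval μ env = .bool true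
    · simp [feelToJava, JExpr.eval, Feel.eval, ihc, ih₁, Lib1.sem, Val.isTrue,
        Val.ofProp_of_true, h]
    · simp [feelToJava, JExpr.eval, Feel.eval, ihc, ih₂, Lib1.sem, Val.isTrue,
        Val.ofProp_of_false not_false, h]
  | iter b l e ihl ihe =>
    intro env
    have := fun u => ihe (u :: env)
    simp only [List.length_cons] at this
    simp only [feelToJava, JExpr.eval, Feel.eval, ihl, Option.bind_some]
    rw [mapM_some (g := fun u => (u, e.eval μ (u :: env)))]
    · rfl
    · intro u; simp [this]

theorem eval_guardToJava (μ : Var → Val) (a r : ℕ → Val) (e : Feel Var) :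
    (guardToJava e).eval μ a r [] = some (Val.ofProp (e.eval μ [] = .bool true)) := by
  have := e.eval_feelToJava μ a r []
  simp only [List.length_nil] at this
  simp [guardToJava, JExpr.eval, this, Lib1.sem, Val.isTrue]

/-- Undefined comparisons become false under `isTrue`, so a cell never aborts a table. For a
two-sided range, three-valued conjunction is true exactly when both end-point tests are. -/
theorem Cell.eval_toJava (μ : Var → Val) (a r : ℕ → Val) (j : ℕ) (c : Cell) :
    (c.toJava j : JExpr Var).eval μ a r [] = some (Val.ofProp (c.Sat (a j))) := by
  match c with
  | .dash => simp [Cell.toJava, JExpr.eval, Cell.Sat, Val.ofProp_of_true]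
  | .const v =>
    simp [Cell.toJava, JExpr.eval, Cell.Sat, Lib1.sem, Lib2.sem, Val.isTrue, Val.eq_eq_true_iff]
  | .cmp .lt v => simp [Cell.toJava, JExpr.eval, Cell.Sat, Lib1.sem, Lib2.sem, Val.isTrue]
  | .cmp .le v => simp [Cell.toJava, JExpr.eval, Cell.Sat, Lib1.sem, Lib2.sem, Val.isTrue]
  | .cmp .gt v => simp [Cell.toJava, JExpr.eval, Cell.Sat, Lib1.sem, Lib2.sem, Val.isTrue]
  | .cmp .ge v => simp [Cell.toJava, JExpr.eval, Cell.Sat, Lib1.sem, Lib2.sem, Val.isTrue]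
  | .between cl lo hi ch =>
    cases cl <;> cases ch <;>
      simp [Cell.toJava, JExpr.eval, Cell.Sat, Lib1.sem, Lib2.sem, Val.isTrue, Val.mem,
        Val.and3_eq_true_iff]

theorem Row.eval_toJava {k n : ℕ} (μ : Var → Val) (a r : ℕ → Val) (row : Row k n) :
    (row.toJava : JExpr Var).eval μ a r [] =
      some (Val.ofProp (row.Sat fun j => a j)) := by
  have key : ∀ l : List (Fin k),
      (l.foldr (fun j e => JExpr.andAlso ((row.cells j).toJava j) e)
        (.const (.bool true)) : JExpr Var).eval μ a r [] =
      some (Val.ofProp (∀ j ∈ l, (row.cells j).Sat (a j))) := by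
    intro l
    induction l with
    | nil => simp [JExpr.eval, Val.ofProp]
    | cons j l ih =>
      simp only [List.foldr_cons, JExpr.eval, Cell.eval_toJava, ih]
      by_cases h : (row.cells j).Sat (a j)
      · simp [Val.ofProp, h]
      · simp [Val.ofProp, h]
  have := key (List.finRange k)
  simpa [Row.toJava, Row.Sat] using this

theorem Flow.holds_iff_of_cond {μ : Var → Val} {w : Flow Node Var} {e : Feel Var} (h : w.guard = .cond e) :
    w.Holds μ ↔ e.eval μ [] = .bool true := by
  simp [Flow.Holds, h]

theorem translateDMN_cons {k n : ℕ} (row : Row k n) (rows : List (Row k n))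
    (d : Option (Fin n → Val)) :
    (translateDMN ⟨k, n, row :: rows, d⟩ : Stmt Node Var Tab) =
      .ifElse row.toJava (setResults row.out) (translateDMN ⟨k, n, rows, d⟩) := by
  cases d <;> rfl

/-! ## Runs -/

variable [DecidableEq Var]

/-- The configuration `c'` occurs in the run from `c`. -/
def Reaches (J : JProgram Node Var Tab) (ι : Inputs Var) :
    Config Node Var Tab → Config Node Var Tab → Prop :=
  Relation.ReflTransGen fun c c' => step J ι c = some c'

/-- The run from `c` finishes with the output `o`. -/
def HaltsWith (J : JProgram Node Var Tab) (ι : Inputs Var) (c : Config Node Var Tab)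
    (o : List (Node × (Var → Val))) : Prop :=
  ∃ c', Reaches J ι c c' ∧ c'.stack = [] ∧ c'.out = o

variable {J : JProgram Node Var Tab} {ι : Inputs Var}

theorem Reaches.trans {c₁ c₂ c₃ : Config Node Var Tab} (h : Reaches J ι c₁ c₂)
    (h' : Reaches J ι c₂ c₃) : Reaches J ι c₁ c₃ := Relation.ReflTransGen.trans h h'

theorem Reaches.refl (c : Config Node Var Tab) : Reaches J ι c c := Relation.ReflTransGen.refl

theorem Reaches.head {c₁ c₂ c₃ : Config Node Var Tab} (h : step J ι c₁ = some c₂)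
    (h' : Reaches J ι c₂ c₃) : Reaches J ι c₁ c₃ := Relation.ReflTransGen.head h h'

theorem Reaches.single {c₁ c₂ : Config Node Var Tab} (h : step J ι c₁ = some c₂) :
    Reaches J ι c₁ c₂ := Relation.ReflTransGen.single h

theorem HaltsWith.of_reaches {c c' : Config Node Var Tab} {o : List (Node × (Var → Val))}
    (h : Reaches J ι c c') (h' : HaltsWith J ι c' o) : HaltsWith J ι c o := by
  obtain ⟨d, hd, h⟩ := h'
  exact ⟨d, Reaches.trans ‹_› hd, h⟩

theorem HaltsWith.of_step {c c' : Config Node Var Tab} {o : List (Node × (Var → Val))}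
    (h : step J ι c = some c') (h' : HaltsWith J ι c' o) : HaltsWith J ι c o :=
  .of_reaches (.single h) h'

theorem HaltsWith.of_abort {c c' : Config Node Var Tab} {o : List (Node × (Var → Val))}
    (h : step J ι c = some c'.abort) (ho : c'.out = o) : HaltsWith J ι c o :=
  ⟨_, .single h, rfl, ho⟩

/-- Since `step` is a function, a run never branches. This locates an arbitrary configuration of a
run before or after a known one. -/
theorem Reaches.total {c d d' : Config Node Var Tab} (h : Reaches J ι c d)
    (h' : Reaches J ι c d') : Reaches J ι d d' ∨ Reaches J ι d' d :=
  Relation.ReflTransGen.total_of_right_unique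
    (fun _ _ _ h h' => Option.some.inj (h.symm.trans h')) h h'

theorem execStmt_out_prefix (c : Config Node Var Tab) (f : Frame Node Var Tab)
    (fs : List (Frame Node Var Tab)) (s : Stmt Node Var Tab) :
    c.out <+: (execStmt J ι c f fs s).out := by
  cases s <;> simp only [execStmt] <;> (try split) <;> simp [Config.abort]

/-- No statement erases output, not even an abortion. Together with `Reaches.total` this confines
the output between two known configurations. -/
theorem Reaches.out_prefix {c c' : Config Node Var Tab} (h : Reaches J ι c c') :
    c.out <+: c'.out := by
  induction h with
  | refl => exact List.prefix_rfl
  | tail _ h ih =>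
    refine ih.trans ?_
    unfold step at h
    split at h
    · cases h
    · split at h
      · cases h; exact List.prefix_rfl
      · cases h; exact execStmt_out_prefix _ _ _ _

theorem Reaches.eq_of_stack_nil {c c' : Config Node Var Tab} (h : Reaches J ι c c')
    (hc : c.stack = []) : c' = c := by
  rcases Relation.ReflTransGen.cases_head h with h | ⟨d, h, _⟩
  · exact h.symm
  · simp [step, hc] at h

/-- After an end event, only the return of all pending calls remains, and returning outputs nothing.
-/
theorem HaltsWith.of_idle {c : Config Node Var Tab} (h : ∀ f ∈ c.stack, f.code = []) :
    HaltsWith J ι c c.out := by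
  obtain ⟨fs, μ, u, o, oc⟩ := c
  -- Popping a frame may change the result object of the frame below it, so the induction is on the
  -- height of the stack and not on the stack itself.
  induction hn : fs.length generalizing fs with
  | zero =>
    obtain rfl := List.length_eq_zero_iff.1 hn
    exact ⟨_, .refl _, rfl, rfl⟩
  | succ n ih =>
    match fs, h with
    | [f], h =>
      refine ⟨⟨[], μ, u, o, oc⟩, .single ?_, rfl, rfl⟩
      simp [step, h f, popFrame]
    | f :: g :: fs, h =>
      refine HaltsWith.of_step (c' := ⟨popFrame f (g :: fs), μ, u, o, oc⟩) ?_ (ih _ ?_ ?_)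
      · simp [step, h f]
      · intro f' hf'
        simp only [popFrame, List.mem_cons] at hf'
        rcases hf' with rfl | hf'
        · split_ifs
          · exact h g (by simp)
          · exact h g (by simp)
        · exact h f' (by simp [hf'])
      · simpa [popFrame] using hn

/-! ## Runs of statements -/

variable {code : List (Stmt Node Var Tab)} {a r : ℕ → Val} {b : Bool}
  {fs : List (Frame Node Var Tab)} {μ : Var → Val} {u : Var → ℕ}
  {o : List (Node × (Var → Val))} {oc : Option Outcome}

theorem step_seq (s t : Stmt Node Var Tab) :
    step J ι ⟨⟨.seq s t :: code, a, r, b⟩ :: fs, μ, u, o, oc⟩ =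
      some ⟨⟨s :: t :: code, a, r, b⟩ :: fs, μ, u, o, oc⟩ := rfl

theorem step_skip :
    step J ι ⟨⟨.skip :: code, a, r, b⟩ :: fs, μ, u, o, oc⟩ =
      some ⟨⟨code, a, r, b⟩ :: fs, μ, u, o, oc⟩ := rfl

/-- All guards produced by the translation evaluate to some `Val.ofProp p`, so that each `if`
becomes a case distinction on `p` and cannot throw. -/
theorem step_ifElse_true {e : JExpr Var} {p : Prop} (s t : Stmt Node Var Tab)
    (he : e.eval μ a r [] = some (Val.ofProp p)) (hp : p) :
    step J ι ⟨⟨.ifElse e s t :: code, a, r, b⟩ :: fs, μ, u, o, oc⟩ =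
      some ⟨⟨s :: code, a, r, b⟩ :: fs, μ, u, o, oc⟩ := by
  simp [step, execStmt, he, Val.ofProp_of_true hp]

theorem step_ifElse_false {e : JExpr Var} {p : Prop} (s t : Stmt Node Var Tab)
    (he : e.eval μ a r [] = some (Val.ofProp p)) (hp : ¬ p) :
    step J ι ⟨⟨.ifElse e s t :: code, a, r, b⟩ :: fs, μ, u, o, oc⟩ =
      some ⟨⟨t :: code, a, r, b⟩ :: fs, μ, u, o, oc⟩ := by
  simp [step, execStmt, he, Val.ofProp_of_false hp]

/-- The argument object changes while it is being filled. Hence `he` asks for the same value under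
every argument object, which holds for translated FEEL expressions because they do not read it. -/
theorem reaches_setArgs {k : ℕ} (e : Fin k → JExpr Var) (y : Fin k → Val)
    (he : ∀ j a, (e j).eval μ a r [] = some (y j)) (l : List (Fin k)) (a : ℕ → Val) :
    ∃ a', Reaches J ι
        ⟨⟨block (l.map fun j : Fin k => .setArg j (e j)) :: code, a, r, b⟩ :: fs, μ, u, o, oc⟩
        ⟨⟨code, a', r, b⟩ :: fs, μ, u, o, oc⟩ ∧
      (∀ j ∈ l, a' j = y j) ∧ ∀ i, (∀ j ∈ l, (j : ℕ) ≠ i) → a' i = a i := by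
  induction l generalizing a with
  | nil => exact ⟨a, .single step_skip, by simp, by simp⟩
  | cons j l ih =>
    obtain ⟨a', hr, hin, hout⟩ := ih (Function.update a j (y j))
    refine ⟨a', .head (step_seq _ _) (.head ?_ hr), ?_, ?_⟩
    · simp [step, execStmt, he, block]
    · intro i hi
      by_cases hil : i ∈ l
      · exact hin i hil
      · obtain rfl : i = j := by simpa [hil] using hi
        rw [hout]
        · simp
        · intro i' hi' h
          exact hil (Fin.ext h ▸ hi')
    · intro i hi
      rw [hout i fun j' hj' => hi j' (by simp [hj']), Function.update_of_ne]
      exact (hi j (by simp)).symm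

theorem reaches_setResults {k : ℕ} (y : Fin k → Val) :
    ∃ r', Reaches J ι ⟨⟨setResults y :: code, a, r, b⟩ :: fs, μ, u, o, oc⟩
        ⟨⟨code, a, r', b⟩ :: fs, μ, u, o, oc⟩ ∧ ∀ j : Fin k, r' j = y j := by
  have key : ∀ (l : List (Fin k)) (r : ℕ → Val), ∃ r', Reaches J ι
        ⟨⟨block (l.map fun j : Fin k => .setRes j (.const (y j))) :: code, a, r, b⟩ :: fs,
          μ, u, o, oc⟩
        ⟨⟨code, a, r', b⟩ :: fs, μ, u, o, oc⟩ ∧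
      (∀ j ∈ l, r' j = y j) ∧ ∀ i, (∀ j ∈ l, (j : ℕ) ≠ i) → r' i = r i := by
    intro l
    induction l with
    | nil => exact fun r => ⟨r, .single step_skip, by simp, by simp⟩
    | cons j l ih =>
      intro r
      obtain ⟨r', hr, hin, hout⟩ := ih (Function.update r j (y j))
      refine ⟨r', .head (step_seq _ _) (.head ?_ hr), ?_, ?_⟩
      · simp [step, execStmt, JExpr.eval, block]
      · intro i hi
        by_cases hil : i ∈ l
        · exact hin i hil
        · obtain rfl : i = j := by simpa [hil] using hi
          rw [hout]
          · simp
          · intro i' hi' h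
            exact hil (Fin.ext h ▸ hi')
      · intro i hi
        rw [hout i fun j' hj' => hi j' (by simp [hj']), Function.update_of_ne]
        exact (hi j (by simp)).symm
  obtain ⟨r', hr, h, -⟩ := key (List.finRange k) r
  exact ⟨r', hr, fun j => h j (List.mem_finRange j)⟩

theorem castTo_of_admissible {T : FType} {v : Val} (h : v = .null ∨ v.HasType T) :
    castTo T v = some v := if_pos h

theorem castTo_of_not_admissible {T : FType} {v : Val} (h : ¬ (v = .null ∨ v.HasType T)) :
    castTo T v = none := if_neg h

theorem step_assign_cast {x : Var} {T : FType} {e : JExpr Var} {v : Val}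
    (he : e.eval μ a r [] = some v) (h : v = .null ∨ v.HasType T) :
    step J ι ⟨⟨.assign x (.cast T e) :: code, a, r, b⟩ :: fs, μ, u, o, oc⟩ =
      some ⟨⟨code, a, r, b⟩ :: fs, Function.update μ x v, u, o, oc⟩ := by
  simp [step, execStmt, JExpr.eval, he, castTo_of_admissible h]

theorem haltsWith_assign_cast {x : Var} {T : FType} {e : JExpr Var} {v : Val}
    (he : e.eval μ a r [] = some v) (h : ¬ (v = .null ∨ v.HasType T)) :
    HaltsWith J ι ⟨⟨.assign x (.cast T e) :: code, a, r, b⟩ :: fs, μ, u, o, oc⟩ o := by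
  refine .of_abort (c' := ⟨⟨.assign x (.cast T e) :: code, a, r, b⟩ :: fs, μ, u, o, oc⟩) ?_ rfl
  simp [step, execStmt, JExpr.eval, he, castTo_of_not_admissible h, Config.abort]

/-- Unpacking of the results of a table. -/
theorem reaches_assignResults {k : ℕ} (outs : Fin k → Var) (houts : Function.Injective outs)
    (ty : Var → FType) (l : List (Fin k)) (μ : Var → Val) :
    (∃ μ', Reaches J ι
        ⟨⟨block (l.map fun j : Fin k => .assign (outs j) (.cast (ty (outs j)) (.res j))) :: code,
          a, r, b⟩ :: fs, μ, u, o, oc⟩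
        ⟨⟨code, a, r, b⟩ :: fs, μ', u, o, oc⟩ ∧
      (∀ j ∈ l, r j = .null ∨ (r j).HasType (ty (outs j))) ∧
      (∀ j ∈ l, μ' (outs j) = r j) ∧ ∀ v, (∀ j ∈ l, outs j ≠ v) → μ' v = μ v) ∨
    (HaltsWith J ι
        ⟨⟨block (l.map fun j : Fin k => .assign (outs j) (.cast (ty (outs j)) (.res j))) :: code,
          a, r, b⟩ :: fs, μ, u, o, oc⟩ o ∧
      ∃ j ∈ l, ¬ (r j = .null ∨ (r j).HasType (ty (outs j)))) := by
  induction l generalizing μ with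
  | nil => exact .inl ⟨μ, .single step_skip, by simp, by simp, by simp⟩
  | cons j l ih =>
    by_cases hj : r j = .null ∨ (r j).HasType (ty (outs j))
    · rcases ih (Function.update μ (outs j) (r j)) with ⟨μ', hr, had, hin, hout⟩ | ⟨hh, i, hi, h⟩
      · refine .inl ⟨μ', .head (step_seq _ _) (.head (step_assign_cast (v := r j) rfl hj) hr),
          ?_, ?_, ?_⟩
        · simpa [hj] using had
        · intro i hi
          by_cases hil : i ∈ l
          · exact hin i hil
          · obtain rfl : i = j := by simpa [hil] using hi
            rw [hout]
            · simp
            -- No later assignment overwrites this variable, because different columns go to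
            -- different variables.
            · intro i' hi' h
              exact hil (houts h ▸ hi')
        · intro i hi
          rw [hout i fun j' hj' => hi j' (by simp [hj']), Function.update_of_ne]
          exact (hi j (by simp)).symm
      · exact .inr ⟨.of_step (step_seq _ _) (.of_step (step_assign_cast (v := r j) rfl hj) hh),
          i, by simp [hi], h⟩
    · exact .inr ⟨.of_step (step_seq _ _) (haltsWith_assign_cast (v := r j) rfl hj),
        j, by simp, hj⟩

/-- A variable may occur several times in `ws`. Each occurrence consumes one input value and only
the last one survives, whence the index `u v + ws.count v - 1`. -/
theorem reaches_readInputs {ty : Var → FType} (ws : List Var)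
    (h : ∀ v ∈ ws, ∀ j, (ι.pick v j).HasType (ty v)) (μ : Var → Val) (u : Var → ℕ) :
    ∃ μ', Reaches J ι ⟨⟨readInputs ty ws :: code, a, r, b⟩ :: fs, μ, u, o, oc⟩
        ⟨⟨code, a, r, b⟩ :: fs, μ', fun v => u v + ws.count v, o, oc⟩ ∧
      (∀ v ∈ ws, μ' v = ι.pick v (u v + ws.count v - 1)) ∧ ∀ v, v ∉ ws → μ' v = μ v := by
  induction ws generalizing μ u with
  | nil => exact ⟨μ, .single step_skip, by simp, by simp⟩
  | cons x ws ih =>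
    obtain ⟨μ', hr, hin, hout⟩ := ih (fun v hv => h v (by simp [hv]))
      (Function.update μ x (ι.pick x (u x))) (Function.update u x (u x + 1))
    have hu : ∀ v, Function.update u x (u x + 1) v + ws.count v = u v + (x :: ws).count v := by
      intro v
      by_cases hv : v = x
      · subst hv; simp; omega
      · simp [hv, Ne.symm hv]
    simp only [hu] at hr hin
    refine ⟨μ', .head (step_seq _ _) (.head ?_ hr), ?_, ?_⟩
    · simp [step, execStmt, castTo_of_admissible (.inr (h x (by simp) (u x))), readInputs, block]
    · intro v hv
      by_cases hvl : v ∈ ws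
      · exact hin v hvl
      · obtain rfl : v = x := by simpa [hvl] using hv
        rw [hout v hvl]
        simp [List.count_eq_zero_of_not_mem hvl]
    · intro v hv
      simp only [List.mem_cons, not_or] at hv
      rw [hout v hv.2, Function.update_of_ne hv.1]

theorem reaches_loads (V : List (Var × FType))
    (h : ∀ p ∈ V, ι.initial p.1 = .null ∨ (ι.initial p.1).HasType p.2) (μ : Var → Val) :
    ∃ μ', Reaches J ι
        ⟨⟨block (V.map fun p => .load p.1 p.2) :: code, a, r, b⟩ :: fs, μ, u, o, oc⟩
        ⟨⟨code, a, r, b⟩ :: fs, μ', u, o, oc⟩ ∧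
      (∀ p ∈ V, μ' p.1 = ι.initial p.1) ∧ ∀ v, (∀ p ∈ V, p.1 ≠ v) → μ' v = μ v := by
  induction V generalizing μ with
  | nil => exact ⟨μ, .single step_skip, by simp, by simp⟩
  | cons p V ih =>
    obtain ⟨μ', hr, hin, hout⟩ := ih (fun q hq => h q (by simp [hq]))
      (Function.update μ p.1 (ι.initial p.1))
    refine ⟨μ', .head (step_seq _ _) (.head ?_ hr), ?_, ?_⟩
    · simp [step, execStmt, castTo_of_admissible (h p (by simp)), block]
    · intro q hq
      -- If the same variable is loaded again later, it receives the same initial value, so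
      -- repetitions in `V` are harmless.
      by_cases hql : ∃ q' ∈ V, q'.1 = q.1
      · obtain ⟨q', hq', he⟩ := hql
        rw [← he, hin q' hq']
      · push Not at hql
        have : q = p := by
          rcases List.mem_cons.1 hq with hq | hq
          · exact hq
          · exact absurd rfl (hql q hq)
        subst this
        rw [hout _ hql, Function.update_self]
    · intro v hv
      rw [hout v fun q hq => hv q (by simp [hq]), Function.update_of_ne]
      exact (hv p (by simp)).symm

/-! ## Decision tables -/

theorem DecisionTable.yields_nil {k n : ℕ} (d : Option (Fin n → Val)) (x : Fin k → Val)
    (y : Fin n → Val) : DecisionTable.Yields ⟨k, n, [], d⟩ x y ↔ d = some y := by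
  simp [DecisionTable.Yields]

/-- With the next lemma, this turns the description by a first satisfied row into a recursion over
the rows, the one followed by the nested `if`s. -/
theorem DecisionTable.yields_cons_of_sat {k n : ℕ} {row : Row k n} (rows : List (Row k n))
    (d : Option (Fin n → Val)) {x : Fin k → Val} (h : row.Sat x) (y : Fin n → Val) :
    DecisionTable.Yields ⟨k, n, row :: rows, d⟩ x y ↔ y = row.out := by
  constructor
  · rintro (⟨pre, r, post, he, hpre, -, hy⟩ | ⟨hn, -⟩)
    · cases pre with
      | nil => simp only [List.nil_append, List.cons.injEq] at he; rw [hy, he.1]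
      | cons p pre =>
        simp only [List.cons_append, List.cons.injEq] at he
        exact absurd (he.1 ▸ h) (hpre p (by simp))
    · exact absurd h (hn row (by simp))
  · rintro rfl
    exact .inl ⟨[], row, rows, rfl, by simp, h, rfl⟩

theorem DecisionTable.yields_cons_of_not_sat {k n : ℕ} {row : Row k n} (rows : List (Row k n))
    (d : Option (Fin n → Val)) {x : Fin k → Val} (h : ¬ row.Sat x) (y : Fin n → Val) :
    DecisionTable.Yields ⟨k, n, row :: rows, d⟩ x y ↔
      DecisionTable.Yields ⟨k, n, rows, d⟩ x y := by
  constructor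
  · rintro (⟨pre, r, post, he, hpre, hr, hy⟩ | ⟨hn, hd⟩)
    · cases pre with
      | nil =>
        simp only [List.nil_append, List.cons.injEq] at he
        exact absurd (he.1 ▸ hr) h
      | cons p pre =>
        simp only [List.cons_append, List.cons.injEq] at he
        exact .inl ⟨pre, r, post, he.2, fun r' hr' => hpre r' (by simp [hr']), hr, hy⟩
    · exact .inr ⟨fun r hr => hn r (by simp at hr ⊢; exact .inr hr), hd⟩
  · rintro (⟨pre, r, post, he, hpre, hr, hy⟩ | ⟨hn, hd⟩)
    · refine .inl ⟨row :: pre, r, post, by simpa using he, ?_, hr, hy⟩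
      intro r' hr'
      rcases List.mem_cons.1 hr' with he' | hr'
      · exact he' ▸ h
      · exact hpre r' hr'
    · refine .inr ⟨fun r hr => ?_, hd⟩
      rcases List.mem_cons.1 hr with he' | hr
      · exact he' ▸ h
      · exact hn r hr

theorem DecisionTable.Yields.unique {T : DecisionTable} {x : Fin T.nIn → Val}
    {y y' : Fin T.nOut → Val} (h : T.Yields x y) (h' : T.Yields x y') : y = y' := by
  obtain ⟨k, n, rows, d⟩ := T
  -- After this the types of the inputs and outputs no longer mention `rows`, over which the
  -- induction runs.
  change Fin k → Val at x
  change Fin n → Val at y y'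
  induction rows with
  | nil =>
    rw [yields_nil] at h h'
    exact Option.some.inj (h.symm.trans h')
  | cons row rows ih =>
    by_cases hs : row.Sat x
    · rw [yields_cons_of_sat _ _ hs] at h h'
      rw [h, h']
    · rw [yields_cons_of_not_sat _ _ hs] at h h'
      exact ih h h'

/-- The `if` for the first row and the recursion for `Yields` branch on the same proposition. At the
end of the rows, a missing default row means both an abortion and the absence of a result. -/
theorem reaches_translateDMN (T : DecisionTable) (x : Fin T.nIn → Val)
    (hx : ∀ j : Fin T.nIn, a j = x j) :
    (∃ r' y, Reaches J ι ⟨⟨translateDMN T :: code, a, r, b⟩ :: fs, μ, u, o, oc⟩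
        ⟨⟨code, a, r', b⟩ :: fs, μ, u, o, oc⟩ ∧
      T.Yields x y ∧ ∀ j : Fin T.nOut, r' j = y j) ∨
    (HaltsWith J ι ⟨⟨translateDMN T :: code, a, r, b⟩ :: fs, μ, u, o, oc⟩ o ∧
      ∀ y, ¬ T.Yields x y) := by
  obtain ⟨k, n, rows, d⟩ := T
  obtain rfl : (fun j : Fin k => a j) = x := funext hx
  induction rows with
  | nil =>
    cases d with
    | none =>
      refine .inr ⟨.of_abort
        (c' := ⟨⟨translateDMN ⟨k, n, [], none⟩ :: code, a, r, b⟩ :: fs, μ, u, o, oc⟩) rfl rfl, ?_⟩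
      simp [DecisionTable.yields_nil]
    | some y =>
      obtain ⟨r', hr, h⟩ := reaches_setResults (J := J) (ι := ι) (code := code) (a := a) (r := r)
        (b := b) (fs := fs) (μ := μ) (u := u) (o := o) (oc := oc) y
      exact .inl ⟨r', y, hr, by simp [DecisionTable.yields_nil], h⟩
  | cons row rows ih =>
    rw [translateDMN_cons]
    by_cases hs : row.Sat fun j => a j
    · obtain ⟨r', hr, h⟩ := reaches_setResults (J := J) (ι := ι) (code := code) (a := a) (r := r)
        (b := b) (fs := fs) (μ := μ) (u := u) (o := o) (oc := oc) row.out
      refine .inl ⟨r', row.out, .head (step_ifElse_true _ _ (row.eval_toJava μ a r) hs) hr, ?_, h⟩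
      rw [DecisionTable.yields_cons_of_sat _ _ hs]
    · simp only [DecisionTable.yields_cons_of_not_sat _ _ hs]
      have hst := step_ifElse_false (J := J) (ι := ι) (code := code) (b := b) (fs := fs) (u := u)
        (o := o) (oc := oc) (setResults row.out) (translateDMN ⟨k, n, rows, d⟩)
        (row.eval_toJava μ a r) hs
      rcases ih (fun _ => rfl) with ⟨r', y, hr, h⟩ | ⟨hh, h⟩
      · exact .inl ⟨r', y, .head hst hr, h⟩
      · exact .inr ⟨.of_step hst hh, h⟩

/-! ## Gateways -/

/-- Flows that do not hold are passed over. A default flow among them is not followed at once but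
replaces the final statement `last`, so it may stand anywhere in the order. -/
theorem reaches_translateG_append (pre post : List (Flow Node Var)) (last : Stmt Node Var Tab)
    (hpre : ∀ w ∈ pre, ¬ w.Holds μ) :
    ∃ last', Reaches J ι
        ⟨⟨translateG (pre ++ post) last :: code, a, r, b⟩ :: fs, μ, u, o, oc⟩
        ⟨⟨translateG post last' :: code, a, r, b⟩ :: fs, μ, u, o, oc⟩ ∧
      ((∀ w ∈ pre, w.guard ≠ .dflt) → last' = last) := by
  induction pre generalizing last with
  | nil => exact ⟨last, .refl _, fun _ => rfl⟩
  | cons w pre ih =>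
    have hpre' : ∀ w ∈ pre, ¬ w.Holds μ := fun w' hw' => hpre w' (by simp [hw'])
    cases hg : w.guard with
    | none =>
      obtain ⟨last', hr, h⟩ := ih last hpre'
      refine ⟨last', ?_, fun hd => h fun w' hw' => hd w' (by simp [hw'])⟩
      simpa only [List.cons_append, translateG, hg] using hr
    | dflt =>
      obtain ⟨last', hr, h⟩ := ih (.invoke (.elem w.tgt)) hpre'
      refine ⟨last', ?_, fun hd => absurd hg (hd w (by simp))⟩
      simpa only [List.cons_append, translateG, hg] using hr
    | cond e =>
      obtain ⟨last', hr, h⟩ := ih last hpre'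
      refine ⟨last', ?_, fun hd => h fun w' hw' => hd w' (by simp [hw'])⟩
      simp only [List.cons_append, translateG, hg]
      refine .head (step_ifElse_false _ _ (eval_guardToJava μ a r e) ?_) hr
      rw [← Flow.holds_iff_of_cond hg]
      exact hpre w (by simp)

theorem exists_first {α : Type*} (p : α → Prop) {l : List α} (h : ∃ x ∈ l, p x) :
    ∃ pre x post, l = pre ++ x :: post ∧ p x ∧ ∀ y ∈ pre, ¬ p y := by
  classical
  induction l with
  | nil => simp at h
  | cons x l ih =>
    by_cases hx : p x
    · exact ⟨[], x, l, rfl, hx, by simp⟩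
    · obtain ⟨pre, y, post, rfl, hy, hpre⟩ := ih (by simpa [hx] using h)
      exact ⟨x :: pre, y, post, rfl, hy, by simpa [hx] using hpre⟩

/-- If one prefix were shorter, its pivot would lie in the other prefix, where `p` fails. -/
theorem first_unique {α : Type*} {p : α → Prop} {x x' : α} {pre pre' post post' : List α}
    (h : pre ++ x :: post = pre' ++ x' :: post') (hx : p x) (hx' : p x')
    (hpre : ∀ y ∈ pre, ¬ p y) (hpre' : ∀ y ∈ pre', ¬ p y) : x = x' := by
  induction pre generalizing pre' with
  | nil =>
    cases pre' with
    | nil => simp at h; exact h.1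
    | cons y pre' =>
      simp only [List.nil_append, List.cons_append, List.cons.injEq] at h
      exact absurd (h.1 ▸ hx) (hpre' y (by simp))
  | cons y pre ih =>
    cases pre' with
    | nil =>
      simp only [List.nil_append, List.cons_append, List.cons.injEq] at h
      exact absurd (h.1 ▸ hx') (hpre y (by simp))
    | cons y' pre' =>
      simp only [List.cons_append, List.cons.injEq] at h
      exact ih h.2 (fun z hz => hpre z (by simp [hz])) fun z hz => hpre' z (by simp [hz])

end

section

variable {Node Var Tab : Type*} {D : Tab → DecisionTable}

/-! ## Transitions -/

namespace BPMN

variable {B : BPMN Node Var D}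

/-- The actions of an element are determined by the values of the variables that it reads in. -/
theorem Acts.unique {n : Node} {μ μ₁ μ₂ : Var → Val} (h₁ : B.Acts n μ μ₁)
    (h₂ : B.Acts n μ μ₂) (h : ∀ v ∈ (B.kind n).userWrites, μ₁ v = μ₂ v) : μ₁ = μ₂ := by
  have assign {x : Var} {y : Val} (h₁ : μ₁ x = y ∧ ∀ v, v ≠ x → μ₁ v = μ v)
      (h₂ : μ₂ x = y ∧ ∀ v, v ≠ x → μ₂ v = μ v) : μ₁ = μ₂ := by
    funext v
    by_cases hv : v = x
    · rw [hv, h₁.1, h₂.1]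
    · rw [h₁.2 v hv, h₂.2 v hv]
  have read {ws : List Var} (h : ∀ v ∈ ws, μ₁ v = μ₂ v) (h₁ : ∀ v, v ∉ ws → μ₁ v = μ v)
      (h₂ : ∀ v, v ∉ ws → μ₂ v = μ v) : μ₁ = μ₂ := by
    funext v
    by_cases hv : v ∈ ws
    · exact h v hv
    · rw [h₁ v hv, h₂ v hv]
  cases hk : B.kind n with
  | start ws | userTask ws | manualTask ws =>
    simp only [hk, Kind.userWrites] at h
    simp only [Acts, hk] at h₁ h₂
    exact read h h₁.2 h₂.2
  | endEvent | task | exclusive | joining =>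
    simp only [Acts, hk] at h₁ h₂
    rw [h₁, h₂]
  | scriptTask w | serviceTask w =>
    rcases w with _ | ⟨x, e⟩ <;> simp only [Acts, hk] at h₁ h₂
    · rw [h₁, h₂]
    · exact assign h₁ h₂
  | businessRuleTask d ins outs =>
    simp only [Acts, hk] at h₁ h₂
    -- A table has at most one result on given inputs, so the output variables agree.
    have hy := h₁.1.unique h₂.1
    funext v
    by_cases hv : ∃ j, outs j = v
    · obtain ⟨j, rfl⟩ := hv
      exact congrFun hy j
    · push Not at hv
      rw [h₁.2 v hv, h₂.2 v hv]

variable [DecidableEq Node]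

theorem mem_outFlows {n : Node} {w : Flow Node Var} :
    w ∈ B.outFlows n ↔ w ∈ B.flows ∧ w.src = n := by
  simp [outFlows]

/-- An element with a single outgoing flow, which has no label. -/
def HasNext (B : BPMN Node Var D) (n : Node) (w : Flow Node Var) : Prop :=
  B.outFlows n = [w] ∧ w.guard = .none

/-- Only a gateway offers a choice. There, two true conditions that are both first coincide, a true
condition closes the default flow, and there is at most one default flow. -/
theorem Open.tgt_unique (hB : B.WellFormed) {μ : Var → Val} {w w' : Flow Node Var}
    (hw : w ∈ B.flows) (hw' : w' ∈ B.flows) (hs : w'.src = w.src) (ho : B.Open μ w)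
    (ho' : B.Open μ w') : w.tgt = w'.tgt := by
  have hm : w ∈ B.outFlows w.src := mem_outFlows.2 ⟨hw, rfl⟩
  have hm' : w' ∈ B.outFlows w.src := mem_outFlows.2 ⟨hw', hs⟩
  have single : (∃ w₀, B.outFlows w.src = [w₀] ∧ w₀.guard = .none) → w.tgt = w'.tgt := by
    rintro ⟨w₀, h, -⟩
    rw [h, List.mem_singleton] at hm hm'
    rw [hm, hm']
  have hd := hB.degrees w.src
  unfold DegreesOK at hd
  split at hd
  · exact single hd.2
  · simp [hd.2] at hm
  · obtain ⟨-, -, hn, hp⟩ := hd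
    unfold Open at ho ho'
    cases hg : w.guard with
    | none => exact absurd hg (hn w hm)
    | cond e =>
      rw [hg] at ho
      obtain ⟨hh, pre, post, he, hpre⟩ := ho
      cases hg' : w'.guard with
      | none => exact absurd hg' (hn w' hm')
      | cond e' =>
        rw [hg'] at ho'
        obtain ⟨hh', pre', post', he', hpre'⟩ := ho'
        rw [hs, he] at he'
        rw [first_unique (p := fun w => w.Holds μ) he' hh hh' hpre hpre']
      | dflt =>
        rw [hg'] at ho'
        exact absurd hh (ho' w (hs ▸ hm))
    | dflt =>
      rw [hg] at ho
      cases hg' : w'.guard with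
      | none => exact absurd hg' (hn w' hm')
      | cond e' =>
        rw [hg'] at ho'
        exact absurd ho'.1 (ho w' hm')
      | dflt =>
        by_contra hne
        have : Std.Symm fun w w' : Flow Node Var => ¬ (w.guard = .dflt ∧ w'.guard = .dflt) :=
          ⟨fun _ _ h h' => h ⟨h'.2, h'.1⟩⟩
        exact hp.forall hm hm' (fun h => hne (h ▸ rfl)) ⟨hg, hg'⟩
  · exact single hd.2
  · exact single hd.2

/-- Apart from the values chosen by the environment, the transition system is deterministic. This
identifies the step of a run with the given step of a path. -/
theorem Trans.unique (hB : B.WellFormed) {s t t' : State Node Var} (h : B.Trans s t)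
    (h' : B.Trans s t') (hv : ∀ v ∈ (B.kind s.node).userWrites, t.val v = t'.val v) :
    t = t' := by
  obtain ⟨-, -, ⟨w, hw, hs, ht, ho⟩, ha⟩ := h
  obtain ⟨-, -, ⟨w', hw', hs', ht', ho'⟩, ha'⟩ := h'
  ext1
  · rw [← ht, ← ht', ho.tgt_unique hB hw hw' (hs'.trans hs.symm) ho']
  · exact ha.unique ha' hv

theorem HasNext.trans {n : Node} {w : Flow Node Var} (hw : B.HasNext n w) {μ μ' : Var → Val}
    (hμ : ⟨n, μ⟩ ∈ B.stateSpace) (hμ' : ∀ v, B.Admissible v (μ' v)) (ha : B.Acts n μ μ') :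
    B.Trans ⟨n, μ⟩ ⟨w.tgt, μ'⟩ := by
  have hm : w ∈ B.outFlows n := by simp [hw.1]
  obtain ⟨hf, hs⟩ := mem_outFlows.1 hm
  exact ⟨hμ, hμ', ⟨w, hf, hs, rfl, by simp [Open, hw.2]⟩, ha⟩

end BPMN

/-! ## Runs of translated elements -/

/-- No frame has code left to run. -/
def Idle (fs : List (Frame Node Var Tab)) : Prop := ∀ f ∈ fs, f.code = []

theorem Idle.cons {fs : List (Frame Node Var Tab)} (h : Idle fs) (a r : ℕ → Val) (b : Bool) :
    Idle (⟨[], a, r, b⟩ :: fs) := by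
  intro f hf
  rcases List.mem_cons.1 hf with rfl | hf
  · rfl
  · exact h f hf

variable [DecidableEq Node] [DecidableEq Var] {B : BPMN Node Var D}
  {ι : Inputs Var}

/-- Three cases: some condition holds and the first such flow is taken; none holds and there is a
default flow; or neither, and then no flow is open and the run fails. -/
theorem reaches_translateG {J : JProgram Node Var Tab} (B : BPMN Node Var D) {n : Node}
    (hn : ∀ w ∈ B.outFlows n, w.guard ≠ .none)
    (hp : (B.outFlows n).Pairwise fun w w' => ¬ (w.guard = .dflt ∧ w'.guard = .dflt))
    {a r : ℕ → Val} {b : Bool} {fs : List (Frame Node Var Tab)} {μ : Var → Val} {u : Var → ℕ}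
    {o : List (Node × (Var → Val))} {oc : Option Outcome} {code : List (Stmt Node Var Tab)} :
    (∃ w ∈ B.outFlows n, B.Open μ w ∧ Reaches J ι
      ⟨⟨translateG (B.outFlows n) .fail :: code, a, r, b⟩ :: fs, μ, u, o, oc⟩
      ⟨⟨.invoke (.elem w.tgt) :: code, a, r, b⟩ :: fs, μ, u, o, oc⟩) ∨
    ((∀ w ∈ B.outFlows n, ¬ B.Open μ w) ∧ HaltsWith J ι
      ⟨⟨translateG (B.outFlows n) .fail :: code, a, r, b⟩ :: fs, μ, u, o, oc⟩ o) := by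
  by_cases hh : ∃ w ∈ B.outFlows n, w.Holds μ
  · obtain ⟨pre, w, post, he, hw, hpre⟩ := exists_first _ hh
    have hm : w ∈ B.outFlows n := by simp [he]
    obtain ⟨e, hg, -⟩ := id hw
    obtain ⟨last', hr, -⟩ := reaches_translateG_append (J := J) (ι := ι) (code := code) (a := a)
      (r := r) (b := b) (fs := fs) (μ := μ) (u := u) (o := o) (oc := oc) pre (w :: post) .fail hpre
    rw [← he] at hr
    refine .inl ⟨w, hm, ?_, hr.trans ?_⟩
    · simp only [BPMN.Open, hg]
      exact ⟨hw, pre, post, by rw [(BPMN.mem_outFlows.1 hm).2, he], hpre⟩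
    · simp only [translateG, hg]
      exact .single (step_ifElse_true _ _ (eval_guardToJava μ a r e)
        ((Flow.holds_iff_of_cond hg).1 hw))
  · push Not at hh
    by_cases hd : ∃ w ∈ B.outFlows n, w.guard = .dflt
    · obtain ⟨w, hm, hg⟩ := hd
      obtain ⟨pre, post, he⟩ := List.append_of_mem hm
      obtain ⟨last', hr, -⟩ := reaches_translateG_append (J := J) (ι := ι) (code := code)
        (a := a) (r := r) (b := b) (fs := fs) (μ := μ) (u := u) (o := o) (oc := oc) pre (w :: post)
        .fail fun w' hw' => hh w' (by simp [he, hw'])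
      obtain ⟨last'', hr', hl⟩ := reaches_translateG_append (J := J) (ι := ι) (code := code)
        (a := a) (r := r) (b := b) (fs := fs) (μ := μ) (u := u) (o := o) (oc := oc) post []
        (.invoke (.elem w.tgt)) fun w' hw' => hh w' (by simp [he, hw'])
      -- The flow `w` discards `last'` in favour of its own call, and this call survives `post`,
      -- which contains no second default flow.
      rw [hl] at hr'
      · simp only [List.append_nil, translateG] at hr'
        rw [← he] at hr
        simp only [translateG, hg] at hr
        refine .inl ⟨w, hm, ?_, hr.trans hr'⟩
        simp only [BPMN.Open, hg]
        rwa [(BPMN.mem_outFlows.1 hm).2]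
      · intro w' hw' hg'
        rw [he, List.pairwise_append, List.pairwise_cons] at hp
        exact hp.2.1.1 w' hw' ⟨hg, hg'⟩
    · push Not at hd
      obtain ⟨last', hr, hl⟩ := reaches_translateG_append (J := J) (ι := ι) (code := code)
        (a := a) (r := r) (b := b) (fs := fs) (μ := μ) (u := u) (o := o) (oc := oc)
        (B.outFlows n) [] .fail hh
      rw [hl hd, List.append_nil] at hr
      refine .inr ⟨fun w hw ho => ?_, .of_reaches hr (.of_abort
        (c' := ⟨⟨.fail :: code, a, r, b⟩ :: fs, μ, u, o, oc⟩) rfl rfl)⟩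
      cases hg : w.guard with
      | none => exact hn w hw hg
      | cond e =>
        simp only [BPMN.Open, hg] at ho
        exact hh w hw ho.1
      | dflt => exact hd w hw hg

variable [Fintype Var]

/-- The method of the element of `s` has been called, with the values of `s`. -/
def entry (B : BPMN Node Var D) (s : State Node Var) (u : Var → ℕ)
    (o : List (Node × (Var → Val))) (fs : List (Frame Node Var Tab)) : Config Node Var Tab :=
  ⟨newFrame (B.translateElem s.node) (fun _ => .null) false :: fs, s.val, u, o, none⟩

/-- The run of the method of an element outputs its state and either follows a transition,
with the next input values, or stops in the absence of transitions. -/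
def Advances (B : BPMN Node Var D) (ι : Inputs Var) (s : State Node Var) (u : Var → ℕ)
    (o : List (Node × (Var → Val))) (fs : List (Frame Node Var Tab)) : Prop :=
  (∃ t fs', B.Trans s t ∧
    (∀ v ∈ (B.kind s.node).userWrites,
      t.val v = ι.pick v (u v + (B.kind s.node).userWrites.count v - 1)) ∧
    Idle fs' ∧
    Reaches B.translate ι (entry B s u o fs)
      (entry B t (fun v => u v + (B.kind s.node).userWrites.count v)
        (o ++ [(s.node, s.val)]) fs')) ∨
  ((∀ t, ¬ B.Trans s t) ∧
    HaltsWith B.translate ι (entry B s u o fs) (o ++ [(s.node, s.val)]))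

section

variable {n : Node} {μ : Var → Val} {u : Var → ℕ} {o : List (Node × (Var → Val))}
  {fs : List (Frame Node Var Tab)} {w : Flow Node Var} {S : Stmt Node Var Tab}

theorem reaches_body (hT : B.translateElem n = .seq (.trace n) S) :
    Reaches B.translate ι (entry B ⟨n, μ⟩ u o fs)
      ⟨⟨[S], fun _ => .null, fun _ => .null, false⟩ :: fs, μ, u, o ++ [(n, μ)], none⟩ := by
  unfold entry newFrame
  simp only [hT]
  exact .head (step_seq _ _) (.single rfl)

theorem reaches_callNext (hw : B.HasNext n w) {a r : ℕ → Val} {b : Bool} :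
    Reaches B.translate ι
      ⟨⟨[callNext (B.outFlows n)], a, r, b⟩ :: fs, μ, u, o, none⟩
      (entry B ⟨w.tgt, μ⟩ u o (⟨[], a, r, b⟩ :: fs)) := by
  rw [hw.1]
  exact .single rfl

/-- For a node with a single outgoing flow it suffices to run its actions. The call of the next
method is in tail position, so the frame left below it is idle. -/
theorem Advances.of_next (hfs : Idle fs) (hw : B.HasNext n w) (hs : ⟨n, μ⟩ ∈ B.stateSpace)
    {μ' : Var → Val} {a r : ℕ → Val}
    (hT : B.translateElem n = .seq (.trace n) S)
    (hr : Reaches B.translate ι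
      ⟨⟨[S], fun _ => .null, fun _ => .null, false⟩ :: fs, μ, u, o ++ [(n, μ)], none⟩
      ⟨⟨[callNext (B.outFlows n)], a, r, false⟩ :: fs, μ',
        fun v => u v + (B.kind n).userWrites.count v, o ++ [(n, μ)], none⟩)
    (hμ' : ∀ v, B.Admissible v (μ' v)) (ha : B.Acts n μ μ')
    (hv : ∀ v ∈ (B.kind n).userWrites,
      μ' v = ι.pick v (u v + (B.kind n).userWrites.count v - 1)) :
    Advances B ι ⟨n, μ⟩ u o fs :=
  .inl ⟨⟨w.tgt, μ'⟩, _, hw.trans hs hμ' ha, hv, hfs.cons a r false,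
    (reaches_body hT).trans (hr.trans (reaches_callNext hw))⟩

theorem Advances.of_halts (hT : B.translateElem n = .seq (.trace n) S)
    (hh : HaltsWith B.translate ι
      ⟨⟨[S], fun _ => .null, fun _ => .null, false⟩ :: fs, μ, u, o ++ [(n, μ)], none⟩
      (o ++ [(n, μ)]))
    (ht : ∀ t, ¬ B.Trans ⟨n, μ⟩ t) : Advances B ι ⟨n, μ⟩ u o fs :=
  .inr ⟨ht, .of_reaches (reaches_body hT) hh⟩

theorem advances_idle (hfs : Idle fs) (hw : B.HasNext n w) (hs : ⟨n, μ⟩ ∈ B.stateSpace)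
    (hT : B.translateElem n = .seq (.trace n) (callNext (B.outFlows n)))
    (hA : ∀ μ', B.Acts n μ μ' ↔ μ' = μ) (hu : (B.kind n).userWrites = []) :
    Advances B ι ⟨n, μ⟩ u o fs :=
  .of_next hfs hw hs hT (by simpa [hu] using Reaches.refl _) hs ((hA μ).2 rfl) (by simp [hu])

theorem advances_read (hfs : Idle fs) (hw : B.HasNext n w) (hs : ⟨n, μ⟩ ∈ B.stateSpace)
    (hι : ∀ v, B.IsInput v → ∀ j, (ι.pick v j).HasType (B.varType v)) {ws : List Var}
    (hT : B.translateElem n =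
      .seq (.trace n) (.seq (readInputs B.varType ws) (callNext (B.outFlows n))))
    (hA : ∀ μ', B.Acts n μ μ' ↔
      (∀ v ∈ ws, (μ' v).HasType (B.varType v)) ∧ ∀ v, v ∉ ws → μ' v = μ v)
    (hu : (B.kind n).userWrites = ws) :
    Advances B ι ⟨n, μ⟩ u o fs := by
  subst hu
  have hws : ∀ v ∈ (B.kind n).userWrites, ∀ j, (ι.pick v j).HasType (B.varType v) :=
    fun v hv => hι v (.inl ⟨n, hv⟩)
  obtain ⟨μ', hr, hin, hout⟩ := reaches_readInputs (J := B.translate)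
    (code := [callNext (B.outFlows n)]) (a := fun _ => .null) (r := fun _ => .null) (b := false)
    (fs := fs) (o := o ++ [(n, μ)]) (oc := none) _ hws μ u
  have hty : ∀ v ∈ (B.kind n).userWrites, (μ' v).HasType (B.varType v) := fun v hv => hin v hv ▸ hws v hv _
  refine .of_next hfs hw hs hT (μ' := μ') (.head (step_seq _ _) hr) (fun v => ?_)
    ((hA μ').2 ⟨hty, hout⟩) hin
  by_cases hv : v ∈ (B.kind n).userWrites
  · exact .inr (hty v hv)
  · rw [hout v hv]; exact hs v

/-- The cast fails exactly when the computed value is inadmissible, and then no target state lies in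
the state space. -/
theorem advances_assign (hfs : Idle fs) (hw : B.HasNext n w) (hs : ⟨n, μ⟩ ∈ B.stateSpace)
    {x : Var} {e : Feel Var}
    (hT : B.translateElem n = .seq (.trace n)
      (.seq (assignFeel B.varType (some (x, e))) (callNext (B.outFlows n))))
    (hA : ∀ μ', B.Acts n μ μ' ↔ μ' x = e.eval μ [] ∧ ∀ v, v ≠ x → μ' v = μ v)
    (hu : (B.kind n).userWrites = []) : Advances B ι ⟨n, μ⟩ u o fs := by
  have he := e.eval_feelToJava μ (fun _ => .null) (fun _ => .null) []
  by_cases had : B.Admissible x (e.eval μ [])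
  · refine .of_next hfs hw hs hT (μ' := Function.update μ x (e.eval μ []))
      (.head (step_seq _ _) (.head (step_assign_cast he had)
        (by simpa [hu] using Reaches.refl _))) (fun v => ?_)
      ((hA _).2 ⟨by simp, fun v hv => by simp [hv]⟩) (by simp [hu])
    by_cases hv : v = x
    · subst hv; simpa using had
    · simpa [hv] using hs v
  · refine .of_halts hT (.of_step (step_seq _ _) (haltsWith_assign_cast he had)) ?_
    rintro t ⟨-, ht, -, ha⟩
    exact had (((hA _).1 ha).1 ▸ ht x)

theorem advances_decide (hfs : Idle fs) (hw : B.HasNext n w) (hs : ⟨n, μ⟩ ∈ B.stateSpace)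
    {d : Tab} {ins : Fin (D d).nIn → Feel Var} {outs : Fin (D d).nOut → Var}
    (houts : Function.Injective outs)
    (hT : B.translateElem n = .seq (.trace n)
      (.seq (translateB D B.varType d ins outs) (callNext (B.outFlows n))))
    (hA : ∀ μ', B.Acts n μ μ' ↔
      (D d).Yields (fun j => (ins j).eval μ []) (fun j => μ' (outs j)) ∧
        ∀ v, (∀ j, outs j ≠ v) → μ' v = μ v)
    (hu : (B.kind n).userWrites = []) : Advances B ι ⟨n, μ⟩ u o fs := by
  have hu' : (fun v => u v + (B.kind n).userWrites.count v) = u := by simp [hu]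
  let assigns : Stmt Node Var Tab := block ((List.finRange (D d).nOut).map
    fun (j : Fin (D d).nOut) => .assign (outs j) (.cast (B.varType (outs j)) (.res j)))
  let nxt := callNext (Tab := Tab) (B.outFlows n)
  obtain ⟨a, hr₁, ha, -⟩ := reaches_setArgs (J := B.translate) (ι := ι)
    (code := [block [.decide d, assigns], nxt]) (r := fun _ => .null) (b := false) (fs := fs)
    (μ := μ) (u := u) (o := o ++ [(n, μ)]) (oc := none) (fun j => feelToJava 0 (ins j))
    (fun j => (ins j).eval μ []) (fun j a => (ins j).eval_feelToJava μ a _ [])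
    (List.finRange (D d).nIn) (fun _ => .null)
  have hr₂ : Reaches B.translate ι
      ⟨⟨[.seq (translateB D B.varType d ins outs) nxt], fun _ => .null, fun _ => .null, false⟩ ::
        fs, μ, u, o ++ [(n, μ)], none⟩
      ⟨⟨[translateDMN (D d)], a, fun _ => .null, true⟩ ::
        ⟨[block [assigns], nxt], a, fun _ => .null, false⟩ :: fs, μ, u, o ++ [(n, μ)], none⟩ :=
    .head (step_seq _ _) (.head (step_seq _ _) (hr₁.trans (.head (step_seq _ _) (.single rfl))))
  rcases reaches_translateDMN (J := B.translate) (ι := ι) (code := []) (a := a)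
      (r := fun _ => .null) (b := true) (fs := ⟨[block [assigns], nxt], a, fun _ => .null, false⟩ ::
        fs) (μ := μ) (u := u) (o := o ++ [(n, μ)]) (oc := none) (D d)
      (fun j => (ins j).eval μ []) (fun j => ha j (List.mem_finRange j)) with
    ⟨r, y, hr₃, hy, hry⟩ | ⟨hh, hy⟩
  -- On return, the result object of the table's frame replaces that of the calling frame.
  · have hr₄ : Reaches B.translate ι
        ⟨⟨[], a, r, true⟩ ::
          ⟨[block [assigns], nxt], a, fun _ => .null, false⟩ :: fs, μ, u, o ++ [(n, μ)], none⟩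
        ⟨⟨[assigns, .skip, nxt], a, r, false⟩ :: fs, μ, u, o ++ [(n, μ)], none⟩ :=
      .head (c₂ := ⟨⟨[block [assigns], nxt], a, r, false⟩ :: fs, μ, u, o ++ [(n, μ)], none⟩)
        rfl (.single rfl)
    have hr := hr₂.trans (hr₃.trans hr₄)
    rcases reaches_assignResults (J := B.translate) (ι := ι) (code := [.skip, nxt]) (a := a)
        (r := r) (b := false) (fs := fs) (u := u) (o := o ++ [(n, μ)]) (oc := none) outs houts
        B.varType (List.finRange (D d).nOut) μ with ⟨μ', hr₅, had, hin, hout⟩ | ⟨hh, j, -, hj⟩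
    · have hin' : ∀ j, μ' (outs j) = y j :=
        fun j => (hin j (List.mem_finRange j)).trans (hry j)
      have hout' : ∀ v, (∀ j, outs j ≠ v) → μ' v = μ v := fun v hv => hout v fun j _ => hv j
      refine .of_next hfs hw hs hT (μ' := μ') (a := a) (r := r)
        (hr.trans (hr₅.trans (.single ?_))) (fun v => ?_)
        ((hA _).2 ⟨by simpa only [hin'] using hy, hout'⟩) (by simp [hu])
      · rw [hu']; rfl
      · by_cases hv : ∃ j, outs j = v
        · obtain ⟨j, rfl⟩ := hv
          have := had j (List.mem_finRange j)
          rw [hry j, ← hin' j] at this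
          exact this
        · push Not at hv
          rw [hout' v hv]
          exact hs v
    · refine .of_halts hT (.of_reaches hr hh) ?_
      rintro t ⟨-, ht, -, hact⟩
      -- A transition would have to assign the unique table result, whose column `j` failed the
      -- cast.
      have := congrFun (((hA _).1 hact).1.unique hy) j
      rw [hry j, ← this] at hj
      exact hj (ht (outs j))
  · refine .of_halts hT (.of_reaches hr₂ hh) ?_
    rintro t ⟨-, -, -, hact⟩
    exact hy _ ((hA _).1 hact).1

end

theorem advances (hB : B.WellFormed)
    (hι : ∀ v, B.IsInput v → ∀ j, (ι.pick v j).HasType (B.varType v)) {s : State Node Var}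
    (hs : s ∈ B.stateSpace) (u : Var → ℕ) (o : List (Node × (Var → Val)))
    {fs : List (Frame Node Var Tab)} (hfs : Idle fs) : Advances B ι s u o fs := by
  obtain ⟨n, μ⟩ := s
  have hd := hB.degrees n
  cases hk : B.kind n with
  | start ws | userTask ws | manualTask ws =>
    simp only [BPMN.DegreesOK, hk] at hd
    obtain ⟨-, w, hw⟩ := hd
    exact advances_read hfs hw hs hι (ws := ws) (by simp only [BPMN.translateElem, hk])
      (fun μ' => by simp only [BPMN.Acts, hk]) (by simp only [hk, Kind.userWrites])
  | task | joining =>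
    simp only [BPMN.DegreesOK, hk] at hd
    obtain ⟨-, w, hw⟩ := hd
    exact advances_idle hfs hw hs (by simp only [BPMN.translateElem, hk])
      (fun μ' => by simp only [BPMN.Acts, hk]) (by simp only [hk, Kind.userWrites])
  | scriptTask x | serviceTask x =>
    simp only [BPMN.DegreesOK, hk] at hd
    obtain ⟨-, w, hw⟩ := hd
    have hu : (B.kind n).userWrites = [] := by simp only [hk, Kind.userWrites]
    rcases x with _ | ⟨x, e⟩
    · refine .of_next hfs hw hs (S := .seq .skip (callNext (B.outFlows n)))
        (by simp only [BPMN.translateElem, hk, assignFeel]) (μ' := μ)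
        (a := fun _ => .null) (r := fun _ => .null)
        (.head (step_seq _ _) (.single ?_)) hs (by simp only [BPMN.Acts, hk]) (by simp [hu])
      simp only [hu, List.count_nil, Nat.add_zero]
      exact step_skip
    · exact advances_assign hfs hw hs (x := x) (e := e) (by simp only [BPMN.translateElem, hk])
        (fun μ' => by simp only [BPMN.Acts, hk]) hu
  | businessRuleTask d ins outs =>
    simp only [BPMN.DegreesOK, hk] at hd
    obtain ⟨-, w, hw⟩ := hd
    exact advances_decide hfs hw hs (ins := ins) (hB.outputs n d ins outs hk)
      (by simp only [BPMN.translateElem, hk])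
      (fun μ' => by simp only [BPMN.Acts, hk]) (by simp only [hk, Kind.userWrites])
  | endEvent e =>
    simp only [BPMN.DegreesOK, hk] at hd
    refine .inr ⟨?_, ?_⟩
    · rintro t ⟨-, -, ⟨w, hw, hs', -⟩, -⟩
      have : w ∈ B.outFlows n := BPMN.mem_outFlows.2 ⟨hw, hs'⟩
      simp [hd.2] at this
    · have hi := hfs.cons (fun _ => .null) (fun _ => .null) false
      cases e with
      | false =>
        refine .of_reaches ((reaches_body (S := .success)
          (by simp only [BPMN.translateElem, hk])).trans (.single rfl)) (.of_idle hi)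
      | true =>
        refine .of_reaches ((reaches_body (S := .error)
          (by simp only [BPMN.translateElem, hk])).trans (.single rfl)) (.of_idle hi)
  | exclusive =>
    simp only [BPMN.DegreesOK, hk] at hd
    obtain ⟨-, -, hn, hp⟩ := hd
    have hT : B.translateElem n = .seq (.trace n) (translateG (B.outFlows n) .fail) := by
      simp only [BPMN.translateElem, hk]
    rcases reaches_translateG (J := B.translate) (ι := ι) B hn hp (code := [])
        (a := fun _ => .null) (r := fun _ => .null) (b := false) (fs := fs) (μ := μ) (u := u)
        (o := o ++ [(n, μ)]) (oc := none) with ⟨w, hw, ho, hr⟩ | ⟨ho, hh⟩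
    · obtain ⟨hf, hs'⟩ := BPMN.mem_outFlows.1 hw
      refine .inl ⟨⟨w.tgt, μ⟩, _,
        ⟨hs, hs, ⟨w, hf, hs', rfl, ho⟩, by simp only [BPMN.Acts, hk]⟩,
        by simp [hk, Kind.userWrites], hfs.cons (fun _ => .null) (fun _ => .null) false,
        (reaches_body hT).trans (hr.trans (.single ?_))⟩
      simp only [hk, Kind.userWrites, List.count_nil, Nat.add_zero]
      rfl
    · refine .of_halts hT hh ?_
      rintro t ⟨-, -, ⟨w, hf, hs', -, hop⟩, -⟩
      exact ho w (BPMN.mem_outFlows.2 ⟨hf, hs'⟩) hop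

end

section

variable {Node Var Tab : Type*} {D : Tab → DecisionTable}

theorem FType.exists_hasType (T : FType) : ∃ x : Val, x.HasType T := by
  cases T with
  | any => exact ⟨.bool true, trivial⟩
  | boolean => exact ⟨.bool true, trivial⟩
  | number => exact ⟨.num 0, trivial⟩
  | string => exact ⟨.str default, trivial⟩
  | temporal k => exact ⟨.temporal k 0, rfl⟩
  | list => exact ⟨.list [], trivial⟩
  | context => exact ⟨.context fun _ => none, trivial⟩
  | range => exact ⟨.range true .null .null true, trivial⟩

/-! ## Correspondence of paths and traces -/

/-- The trace entry of a state. -/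
def State.toEntry (s : State Node Var) : Node × (Var → Val) := (s.node, s.val)

theorem State.toEntry_injective : Function.Injective (State.toEntry (Node := Node) (Var := Var)) := by
  rintro ⟨n, μ⟩ ⟨n', μ'⟩ h
  simpa [State.toEntry] using h

/-- Pointwise agreement of values is equality of functions. In this form each side of the
correspondence determines the other. -/
theorem corresponds_iff {p : List (State Node Var)} {tr : List (Node × (Var → Val))} :
    Corresponds p tr ↔ p.map State.toEntry = tr := by
  rw [← List.forall₂_eq_eq_eq, List.forall₂_map_left_iff]
  have : (fun (s : State Node Var) (e : Node × (Var → Val)) => s.node = e.1 ∧ ∀ v, s.val v = e.2 v) =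
      fun s e => s.toEntry = e := by
    funext s e
    rw [Prod.ext_iff, ← funext_iff (f := s.val)]
    rfl
  rw [Corresponds, this]

/-! ## Inputs -/

/-- Here `pre` holds the values already used, and the block of equal values feeds all occurrences of
`v` in one node; the index is that of the last copy. -/
theorem Inputs.pick_append_replicate {ι : Inputs Var} {v : Var} {pre post : List Val} {x : Val}
    {k : ℕ} (h : ι.values v = pre ++ (List.replicate (k + 1) x ++ post)) :
    ι.pick v (pre.length + k) = x := by
  simp [Inputs.pick, h, List.getD_eq_getElem?_getD, List.getElem?_append_right,
    List.getElem?_append_left]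

/-- An exhausted list repeats its last value, which exists because legal lists are non-empty. -/
theorem Inputs.Legal.pick_hasType {ι : Inputs Var} {V : List (Var × FType)} (h : ι.Legal V)
    {p : Var × FType} (hp : p ∈ V) (j : ℕ) : (ι.pick p.1 j).HasType p.2 := by
  obtain ⟨-, hne, hty⟩ := h p hp
  apply hty
  unfold Inputs.pick
  by_cases hj : j < (ι.values p.1).length
  · rw [List.getD_eq_getElem _ _ hj]
    exact List.getElem_mem hj
  · rw [List.getD_eq_default _ _ (not_lt.1 hj), List.getLastD_eq_getLast?,
      List.getLast?_eq_some_getLast hne]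
    exact List.getLast_mem hne

namespace BPMN

variable {B : BPMN Node Var D}

theorem mem_inputVars [Fintype Var] {p : Var × FType} :
    p ∈ B.inputVars ↔ B.IsInput p.1 ∧ B.varType p.1 = p.2 := by
  obtain ⟨v, T⟩ := p
  simp [inputVars]

theorem Acts.hasType {n : Node} {μ μ' : Var → Val} (h : B.Acts n μ μ') {v : Var}
    (hv : v ∈ (B.kind n).userWrites) : (μ' v).HasType (B.varType v) := by
  cases hk : B.kind n with
  | start ws | userTask ws | manualTask ws =>
    simp only [hk, Kind.userWrites] at hv
    simp only [Acts, hk] at h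
    exact h.1 v hv
  | _ => simp [hk, Kind.userWrites] at hv

/-- The values that are chosen for the variable `v` along a path. -/
def writes [DecidableEq Var] (B : BPMN Node Var D) (v : Var) : List (State Node Var) → List Val
  | s :: t :: l =>
    -- One copy for each read of `v` at this node, all equal to the value visible in the next state.
    -- The last state contributes nothing, since its actions lie beyond the path.
    List.replicate ((B.kind s.node).userWrites.count v) (t.val v) ++ B.writes v (t :: l)
  | _ => []

theorem hasType_of_mem_writes [DecidableEq Node] [DecidableEq Var] {v : Var} {x : Val} :
    ∀ {p : List (State Node Var)}, p.IsChain B.Trans → x ∈ B.writes v p →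
      x.HasType (B.varType v)
  | [], _, hx => by simp [writes] at hx
  | [_], _, hx => by simp [writes] at hx
  | s :: t :: l, hp, hx => by
    rw [List.isChain_cons_cons] at hp
    rw [writes, List.mem_append, List.mem_replicate] at hx
    rcases hx with ⟨hc, rfl⟩ | hx
    · exact hp.1.2.2.2.hasType (List.count_pos_iff.1 (Nat.pos_of_ne_zero hc))
    · exact hasType_of_mem_writes hp.2 hx

end BPMN

/-! ## Runs of translated processes -/

variable [DecidableEq Node] [DecidableEq Var] [Fintype Var] {B : BPMN Node Var D}
  {ι : Inputs Var}

/-- Initialization loads exactly the input variables, so process variables stay `null` and the state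
reached is initial. The frames of `main` and `execute` remain below, with nothing left to do. -/
theorem reaches_entry_of_legal (hB : B.WellFormed) (hι : ι.Legal B.inputVars) :
    ∃ s fs, B.Initial s ∧ Idle fs ∧ (∀ v, B.IsInput v → s.val v = ι.initial v) ∧
      Reaches B.translate ι (initialConfig B.translate) (entry B s (fun _ => 0) [] fs) := by
  obtain ⟨μ, hr, hin, hout⟩ := reaches_loads (J := B.translate) (ι := ι) (code := [])
    (a := fun _ => .null) (r := fun _ => .null) (b := false)
    (fs := [⟨[.invoke .execute], fun _ => .null, fun _ => .null, false⟩]) (u := fun _ => 0)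
    (o := []) (oc := none) B.inputVars (fun p hp => (hι p hp).1) fun _ => .null
  have hin' : ∀ v, B.IsInput v → μ v = ι.initial v :=
    fun v hv => hin (v, B.varType v) (BPMN.mem_inputVars.2 ⟨hv, rfl⟩)
  have hout' : ∀ v, ¬ B.IsInput v → μ v = .null := by
    refine fun v hv => hout v fun p hp h => hv ?_
    exact h ▸ (BPMN.mem_inputVars.1 hp).1
  refine ⟨⟨B.startNode, μ⟩,
    [⟨[], fun _ => .null, fun _ => .null, false⟩, ⟨[], fun _ => .null, fun _ => .null, false⟩],
    ⟨fun v => ?_, (hB.start _).2 rfl, hout'⟩, ?_, hin', ?_⟩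
  · by_cases hv : B.IsInput v
    · have := (hι _ (BPMN.mem_inputVars.2 ⟨hv, rfl⟩ : (v, B.varType v) ∈ B.inputVars)).1
      rw [← hin' v hv] at this
      exact this
    · exact .inl (hout' v hv)
  · intro f hf
    simp only [List.mem_cons, List.not_mem_nil, or_false, or_self] at hf
    rw [hf]
  · refine .head (c₂ := ⟨⟨[.invoke .init, .invoke .execute], fun _ => .null, fun _ => .null,
      false⟩ :: [], fun _ => .null, fun _ => 0, [], none⟩) rfl (.head rfl (hr.trans ?_))
    exact .head rfl (.head rfl (.single rfl))

/-- The number `k` bounds the entries still to be output; each method call uses up one. If `c` comes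
before the next entry, its output is squeezed between `o` and `o` with `s` appended. -/
theorem exists_chain_of_reaches (hB : B.WellFormed)
    (hι : ∀ v, B.IsInput v → ∀ j, (ι.pick v j).HasType (B.varType v))
    {c : Config Node Var Tab} (k : ℕ) {s : State Node Var} (hs : s ∈ B.stateSpace)
    {u : Var → ℕ} {o : List (Node × (Var → Val))} {fs : List (Frame Node Var Tab)}
    (hfs : Idle fs) (hr : Reaches B.translate ι (entry B s u o fs) c)
    (hk : c.out.length ≤ o.length + k) :
    c.out = o ∨ ∃ l, (s :: l).IsChain B.Trans ∧ c.out = o ++ (s :: l).map State.toEntry := by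
  induction k generalizing s u o fs with
  | zero => exact .inl (hr.out_prefix.eq_of_length_le hk).symm
  | succ k ih =>
    have hpre : o <+: c.out := hr.out_prefix
    have last (h : c.out <+: o ++ [s.toEntry]) :
        c.out = o ∨ ∃ l, (s :: l).IsChain B.Trans ∧ c.out = o ++ (s :: l).map State.toEntry := by
      rcases List.prefix_concat_iff.1 h with h | h
      · exact .inr ⟨[], by simp, by simpa using h⟩
      · exact .inl (h.eq_of_length_le hpre.length_le)
    rcases advances hB hι hs u o hfs with ⟨t, fs', ht, -, hfs', hr'⟩ | ⟨-, c', hr', hst, ho⟩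
    · rcases hr.total hr' with h | h
      · exact last h.out_prefix
      · have hlen : c.out.length ≤ (o ++ [s.toEntry]).length + k := by simp; omega
        right
        rcases ih ht.2.1 hfs' h hlen with h | ⟨l, hl, h⟩
        · exact ⟨[], by simp, by simpa [State.toEntry] using h⟩
        · exact ⟨t :: l, List.isChain_cons_cons.2 ⟨ht, hl⟩, by simpa [State.toEntry] using h⟩
    · rcases hr.total hr' with h | h
      · exact last (ho ▸ h.out_prefix)
      · rw [h.eq_of_stack_nil hst] at last ⊢
        exact last (ho ▸ List.prefix_rfl)

/-- Invariant `hv`: each input list consists of the `u v` values already used, the values needed by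
the rest of the path, and a remainder. -/
theorem exists_reaches_of_chain (hB : B.WellFormed)
    (hι : ∀ v, B.IsInput v → ∀ j, (ι.pick v j).HasType (B.varType v))
    (l : List (State Node Var)) {s : State Node Var} (hs : s ∈ B.stateSpace)
    (hl : (s :: l).IsChain B.Trans)
    {u : Var → ℕ} {o : List (Node × (Var → Val))} {fs : List (Frame Node Var Tab)}
    (hfs : Idle fs)
    (hv : ∀ v, ∃ pre post, ι.values v = pre ++ (B.writes v (s :: l) ++ post) ∧
      pre.length = u v) :
    ∃ c, Reaches B.translate ι (entry B s u o fs) c ∧ c.out = o ++ (s :: l).map State.toEntry := by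
  induction l generalizing s u o fs with
  | nil =>
    rcases advances hB hι hs u o hfs with ⟨t, fs', -, -, -, hr⟩ | ⟨-, c, hr, -, ho⟩
    · exact ⟨_, hr, rfl⟩
    · exact ⟨c, hr, ho⟩
  | cons t l ih =>
    rw [List.isChain_cons_cons] at hl
    rcases advances hB hι hs u o hfs with ⟨t', fs', ht, hval, hfs', hr⟩ | ⟨h, -⟩
    -- The run reads the very values that the path chooses here, so determinism forces the same
    -- target.
    · have : t' = t := by
        refine ht.unique hB hl.1 fun v hw => ?_
        obtain ⟨pre, post, he, hlen⟩ := hv v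
        obtain ⟨k, hk⟩ := Nat.exists_eq_succ_of_ne_zero (List.count_pos_iff.2 hw).ne'
        rw [hval v hw, hk, ← hlen]
        rw [BPMN.writes, hk, List.append_assoc] at he
        exact ι.pick_append_replicate he
      subst this
      obtain ⟨c, hc, ho⟩ := ih (o := o ++ [(s.node, s.val)]) hl.1.2.1 hl.2 hfs'
        (u := fun v => u v + (B.kind s.node).userWrites.count v) (fun v => by
          obtain ⟨pre, post, he, hlen⟩ := hv v
          -- The block just read moves to the used part.
          refine ⟨pre ++ List.replicate ((B.kind s.node).userWrites.count v) (t'.val v), post, ?_,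
            by simp [hlen]⟩
          simpa [BPMN.writes] using he)
      exact ⟨c, hr.trans hc, by simp [ho, State.toEntry]⟩
    · exact absurd hl.1 (h t)

theorem exists_path_of_isTrace (hB : B.WellFormed) {tr : List (Node × (Var → Val))}
    (h : IsTrace B.translate B.inputVars tr) :
    ∃ p, B.IsPath p ∧ p.map State.toEntry = tr := by
  obtain ⟨hne, ι, hι, c, hr, rfl⟩ := h
  obtain ⟨s, fs, hs, hfs, -, hr'⟩ := reaches_entry_of_legal hB hι
  have hpick : ∀ v, B.IsInput v → ∀ j, (ι.pick v j).HasType (B.varType v) :=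
    fun v hv => hι.pick_hasType (BPMN.mem_inputVars.2 ⟨hv, rfl⟩ : (v, B.varType v) ∈ B.inputVars)
  rcases Reaches.total hr hr' with h | h
  -- During initialization nothing has been output, whereas traces are non-empty.
  · exact absurd (List.prefix_nil.1 h.out_prefix) hne
  · rcases exists_chain_of_reaches hB hpick c.out.length hs.1 hfs h (by simp) with h | ⟨l, hl, h⟩
    · exact absurd h hne
    · exact ⟨s :: l, ⟨⟨s, rfl, hs⟩, hl⟩, by simpa using h.symm⟩

theorem isTrace_of_isPath (hB : B.WellFormed) {p : List (State Node Var)} (hp : B.IsPath p) :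
    IsTrace B.translate B.inputVars (p.map State.toEntry) := by
  obtain ⟨⟨s, hhead, hs⟩, hc⟩ := hp
  obtain ⟨l, rfl⟩ := List.head?_eq_some_iff.1 hhead
  choose dflt hdflt using FType.exists_hasType
  -- The appended value keeps the list non-empty when the path makes no choice for `v`, and also
  -- serves reads after the end of the path.
  let ι : Inputs Var := ⟨s.val, fun v => B.writes v (s :: l) ++ [dflt (B.varType v)]⟩
  have hι : ι.Legal B.inputVars := by
    rintro ⟨v, T⟩ hv
    obtain rfl : B.varType v = T := (BPMN.mem_inputVars.1 hv).2
    refine ⟨hs.1 v, by simp [ι], fun x hx => ?_⟩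
    simp only [ι, List.mem_append, List.mem_singleton] at hx
    rcases hx with hx | rfl
    · exact BPMN.hasType_of_mem_writes hc hx
    · exact hdflt _
  have hpick : ∀ v, B.IsInput v → ∀ j, (ι.pick v j).HasType (B.varType v) :=
    fun v hv => hι.pick_hasType (BPMN.mem_inputVars.2 ⟨hv, rfl⟩ : (v, B.varType v) ∈ B.inputVars)
  obtain ⟨s', fs, hs', hfs, hin, hr⟩ := reaches_entry_of_legal hB hι
  obtain rfl : s' = s := by
    ext v
    · rw [(hB.start _).1 hs.2.1, (hB.start _).1 hs'.2.1]
    · by_cases hv : B.IsInput v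
      · exact hin v hv
      · rw [hs.2.2 v hv, hs'.2.2 v hv]
  obtain ⟨c, hr', ho⟩ := exists_reaches_of_chain hB hpick l hs.1 hc (u := fun _ => 0) (o := [])
    hfs fun v => ⟨[], [dflt (B.varType v)], rfl, rfl⟩
  exact ⟨by simp, ι, hι, c, hr.trans hr', ho⟩

end

end BDT

end

/-! ### The bijection between paths and traces. -/

theorem theorem1 {Node Var Tab : Type*} [DecidableEq Node] [Fintype Var] [DecidableEq Var]
    (D : Tab → BDT.DecisionTable) (B : BDT.BPMN Node Var D)
    (hB : B.WellFormed) (hloop : B.NoInputInLoop) :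
    (∀ p : List (BDT.State Node Var), B.IsPath p →
      ∃! tr : List (Node × (Var → BDT.Val)),
        BDT.IsTrace (BDT.BDTrans B).program (BDT.BDTrans B).inputs tr ∧ BDT.Corresponds p tr) ∧
    (∀ tr : List (Node × (Var → BDT.Val)),
      BDT.IsTrace (BDT.BDTrans B).program (BDT.BDTrans B).inputs tr →
        ∃! p : List (BDT.State Node Var), B.IsPath p ∧ BDT.Corresponds p tr) := by
  refine ⟨fun p hp => ?_, fun tr htr => ?_⟩
  · exact ⟨p.map BDT.State.toEntry, ⟨BDT.isTrace_of_isPath hB hp, BDT.corresponds_iff.2 rfl⟩,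
      fun tr htr => (BDT.corresponds_iff.1 htr.2).symm⟩
  · obtain ⟨p, hp, rfl⟩ := BDT.exists_path_of_isTrace hB htr
    exact ⟨p, ⟨hp, BDT.corresponds_iff.2 rfl⟩, fun q hq =>
      BDT.State.toEntry_injective.list_map (BDT.corresponds_iff.1 hq.2)⟩
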